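/- Let $\mathcal C$ be a category with finite colimits, with coproduct $+$ and initial object $\varnothing$. Let $(\mathcal E,\mathcal M)$ be a factorisation system on $\mathcal C$: $\mathcal E$ and $\mathcal M$ are subcategories containing all isomorphisms, every morphism factors as $m\circ e$ with $e\in\mathcal E$, $m\in\mathcal M$, and whenever $v\circ(m\circ e)=(m'\circ e')\circ u$ with $e,e'\in\mathcal E$, $m,m'\in\mathcal M$, there is a unique $s$ with $s\circ e=e'\circ u$ and $m'\circ s=v\circ m$. Assume that it is costable, i.e. that $\mathcal M$ is stable under pushout. Let $\mathcal C;\mathcal M^{\mathrm{op}}$ be the symmetric monoidal category with the objects of $\mathcal C$, whose morphisms $X\to Y$ are the isomorphism classes of cospans $X\xrightarrow{f}N\xleftarrow{m}Y$ with $m\in\mathcal M$, with composition by pushout, monoidal product $+$, and the coherence maps of $(\mathcal C,+)$. A morphism $f\colon X\to Y$ of $\mathcal C$ is regarded as the cospan $X\xrightarrow{f}Y\xleftarrow{1}Y$, and for $m\colon X\to Y$ in $\mathcal M$ we write $m^{\mathrm{op}}\colon Y\to X$ for the cospan $Y\xrightarrow{1}Y\xleftarrow{m}X$. Let $$(F,\varphi)\colon(\mathcal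 C;\mathcal M^{\mathrm{op}},+)\longrightarrow(\mathrm{Set},\times)$$ be a lax symmetric monoidal functor. An $F$-decorated cospan from $X$ to $Y$ is a cospan $X\xrightarrow{i}N\xleftarrow{o}Y$ in $\mathcal C$ with an element $s\in FN$; it is an $F$-decorated corelation if the copairing $[i,o]\colon X+Y\to N$ lies in $\mathcal E$. An isomorphism from $(N,i,o,s)$ to $(N',i',o',s')$ is an isomorphism $n\colon N\to N'$ with $n i=i'$, $n o=o'$ and $Fn(s)=s'$. The empty decoration on $N$ is the image of the point under $1\xrightarrow{\varphi_1}F\varnothing\xrightarrow{F!}FN$. For an $F$-decorated cospan $(N,i,o,s)$, factor $[i,o]$ as $X+Y\xrightarrow{e}\overline N\xrightarrow{m}N$ with $e\in\mathcal E$, $m\in\mathcal M$, and let $\square(N,i,o,s)$ be the $F$-decorated corelation $(\overline N,\,e\iota_X,\,e\iota_Y,\,F(m^{\mathrm{op}})(s))$; its decoration is called the restriction of $s$. Then the following data are well defined and form a hypergraph category $F\mathrm{Corel}$, that is, a symmetric monoidal category in which each object $X$ carries a special commutative Frobenius monoid structure $(\mu_X,\eta_X,\delta_X,\epsilon_X)$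 such that $$\mu_{X\otimes Y}=(\mu_X\otimes\mu_Y)(1_X\otimes\sigma_{Y,X}\otimes1_Y),\quad \eta_{X\otimes Y}=\eta_X\otimes\eta_Y,\quad \delta_{X\otimes Y}=(1_X\otimes\sigma_{X,Y}\otimes1_Y)(\delta_X\otimes\delta_Y),\quad \epsilon_{X\otimes Y}=\epsilon_X\otimes\epsilon_Y$$ (up to the coherence isomorphisms, with $\sigma$ the braiding): - the objects are the objects of $\mathcal C$, and the morphisms $X\to Y$ are the isomorphism classes of $F$-decorated corelations from $X$ to $Y$; - the composite of $(X\xrightarrow{i_X}N\xleftarrow{o_Y}Y,\ s)$ and $(Y\xrightarrow{i_Y}M\xleftarrow{o_Z}Z,\ t)$ is the class of $\square\big(X\xrightarrow{j_Ni_X}N+_YM\xleftarrow{j_Mo_Z}Z,\ F[j_N,j_M](\varphi_{N,M}(s,t))\big)$, where $j_N,j_M$ are the maps into the pushout; - the monoidal product is $X+Y$ on objects with unit $\varnothing$, and on morphisms it is the coproduct of cospans with decoration $\varphi_{N,M}(s,t)$; - the identities, the associators, the unitors and the braidings are the classes of $\square(X\xrightarrow{f}Y\xleftarrow{1}Y)$,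 with the empty decoration on the cospan, where $f$ is the corresponding structure map of $(\mathcal C,+)$; - the Frobenius maps $\mu_X,\eta_X,\delta_X,\epsilon_X$ are the classes of $\square$ of the cospans $X+X\xrightarrow{[1,1]}X\xleftarrow{1}X$, $\varnothing\xrightarrow{!}X\xleftarrow{1}X$, $X\xrightarrow{1}X\xleftarrow{[1,1]}X+X$ and $X\xrightarrow{1}X\xleftarrow{!}\varnothing$, each with the empty decoration. -/

import Mathlib

open CategoryTheory Limits MonoidalCategory

universe w v u

noncomputable section

namespace DecoratedCorelation

/-! ### Hypergraph categories -/

/-- A special commutative Frobenius monoid in a symmetric monoidal category: a commutative monoid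
and cocommutative comonoid satisfying the Frobenius and the special axioms. -/
class SpecialCommFrobenius {D : Type u} [Category.{v} D] [MonoidalCategory D]
    [SymmetricCategory D] (X : D) extends MonObj X, ComonObj X where
  mul_comm : (β_ X X).hom ≫ mul = mul
  comul_comm : comul ≫ (β_ X X).hom = comul
  frobenius_left : (comul ▷ X) ≫ (α_ X X X).hom ≫ (X ◁ mul) = mul ≫ comul
  frobenius_right : (X ◁ comul) ≫ (α_ X X X).inv ≫ (mul ▷ X) = mul ≫ comul
  special : comul ≫ mul = 𝟙 X

/-- A hypergraph category: a symmetric monoidal category in which every object carries a special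
commutative Frobenius structure, compatibly with the monoidal product.  The middle four
interchange `(X ⊗ Y) ⊗ (X ⊗ Y) ⟶ (X ⊗ X) ⊗ (Y ⊗ Y)` is Mathlib's `tensorμ X Y X Y`. -/
class HypergraphCategory (D : Type u) [Category.{v} D] [MonoidalCategory D]
    [SymmetricCategory D] where
  frob (X : D) : SpecialCommFrobenius X
  mul_tensor (X Y : D) :
    (frob (X ⊗ Y)).mul = tensorμ X Y X Y ≫ ((frob X).mul ⊗ₘ (frob Y).mul)
  one_tensor (X Y : D) :
    (frob (X ⊗ Y)).one = (λ_ (𝟙_ D)).inv ≫ ((frob X).one ⊗ₘ (frob Y).one)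
  comul_tensor (X Y : D) :
    (frob (X ⊗ Y)).comul = ((frob X).comul ⊗ₘ (frob Y).comul) ≫ tensorμ X X Y Y
  counit_tensor (X Y : D) :
    (frob (X ⊗ Y)).counit = ((frob X).counit ⊗ₘ (frob Y).counit) ≫ (λ_ (𝟙_ D)).hom

/-- The operations of a hypergraph category with a given collection of objects, without any
axioms.  It is only used, through `HypergraphData.of`, to say which hypergraph category is
meant. -/
@[ext]
structure HypergraphData (Obj : Type u) where
  Hom : Obj → Obj → Type v
  id (X : Obj) : Hom X X
  comp {X Y Z : Obj} : Hom X Y → Hom Y Z → Hom X Z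
  tensorObj : Obj → Obj → Obj
  tensorHom {X Y X' Y' : Obj} : Hom X Y → Hom X' Y' → Hom (tensorObj X X') (tensorObj Y Y')
  tensorUnit : Obj
  associator (X Y Z : Obj) : Hom (tensorObj (tensorObj X Y) Z) (tensorObj X (tensorObj Y Z))
  leftUnitor (X : Obj) : Hom (tensorObj tensorUnit X) X
  rightUnitor (X : Obj) : Hom (tensorObj X tensorUnit) X
  braiding (X Y : Obj) : Hom (tensorObj X Y) (tensorObj Y X)
  mul (X : Obj) : Hom (tensorObj X X) X
  one (X : Obj) : Hom tensorUnit X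
  comul (X : Obj) : Hom X (tensorObj X X)
  counit (X : Obj) : Hom X tensorUnit

/-- The operations underlying a hypergraph category. -/
def HypergraphData.of (D : Type u) [Category.{v} D] [MonoidalCategory D] [SymmetricCategory D]
    [H : HypergraphCategory D] : HypergraphData.{v} D where
  Hom X Y := X ⟶ Y
  id X := 𝟙 X
  comp f g := f ≫ g
  tensorObj X Y := X ⊗ Y
  tensorHom f g := f ⊗ₘ g
  tensorUnit := 𝟙_ D
  associator X Y Z := (α_ X Y Z).hom
  leftUnitor X := (λ_ X).hom
  rightUnitor X := (ρ_ X).hom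
  braiding X Y := (β_ X Y).hom
  mul X := (H.frob X).mul
  one X := (H.frob X).one
  comul X := (H.frob X).comul
  counit X := (H.frob X).counit

attribute [local simp] coprod.inl_desc coprod.inr_desc coprod.inl_desc_assoc coprod.inr_desc_assoc

variable {C : Type u} [Category.{v} C]

/-! ### Factorisation systems -/

variable (C) in
/-- An (orthogonal) factorisation system `(E, M)`. -/
structure FactorisationSystem where
  E : MorphismProperty C
  M : MorphismProperty C
  E_mul : E.IsMultiplicative
  M_mul : M.IsMultiplicative
  iso_E {X Y : C} (f : X ⟶ Y) [IsIso f] : E f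
  iso_M {X Y : C} (f : X ⟶ Y) [IsIso f] : M f
  factor {X Y : C} (f : X ⟶ Y) : ∃ (N : C) (e : X ⟶ N) (m : N ⟶ Y), E e ∧ M m ∧ e ≫ m = f
  fill {A N B A' N' B' : C} (e : A ⟶ N) (m : N ⟶ B) (e' : A' ⟶ N') (m' : N' ⟶ B')
    (u : A ⟶ A') (v : B ⟶ B') : E e → M m → E e' → M m' →
    (e ≫ m) ≫ v = u ≫ (e' ≫ m') → ∃! s : N ⟶ N', e ≫ s = u ≫ e' ∧ m ≫ v = s ≫ m'

attribute [instance] FactorisationSystem.E_mul FactorisationSystem.M_mul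

namespace FactorisationSystem

/-- `(E, M)` is costable if `M` is stable under pushout. -/
class Costable (fs : FactorisationSystem C) : Prop where
  stable : fs.M.IsStableUnderCobaseChange

attribute [instance] Costable.stable

variable (fs : FactorisationSystem C)

/-- The object through which the chosen factorisation `f = m ∘ e` passes. -/
def mid {X Y : C} (f : X ⟶ Y) : C := (fs.factor f).choose
/-- The `E`-factor of the chosen factorisation of `f`. -/
def e {X Y : C} (f : X ⟶ Y) : X ⟶ fs.mid f := (fs.factor f).choose_spec.choose
/-- The `M`-factor of the chosen factorisation of `f`. -/
def m {X Y : C} (f : X ⟶ Y) : fs.mid f ⟶ Y := (fs.factor f).choose_spec.choose_spec.choose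

lemma e_mem {X Y : C} (f : X ⟶ Y) : fs.E (fs.e f) :=
  (fs.factor f).choose_spec.choose_spec.choose_spec.1
lemma m_mem {X Y : C} (f : X ⟶ Y) : fs.M (fs.m f) :=
  (fs.factor f).choose_spec.choose_spec.choose_spec.2.1
lemma e_m {X Y : C} (f : X ⟶ Y) : fs.e f ≫ fs.m f = f :=
  (fs.factor f).choose_spec.choose_spec.choose_spec.2.2

/-- Factorisations of the same morphism up to an isomorphism of the codomain agree. -/
lemma exists_iso {A N B N' B' : C} {e : A ⟶ N} {m : N ⟶ B} {e' : A ⟶ N'} {m' : N' ⟶ B'}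
    (n : B ≅ B') (he : fs.E e) (hm : fs.M m) (he' : fs.E e') (hm' : fs.M m')
    (h : (e ≫ m) ≫ n.hom = e' ≫ m') :
    ∃ s : N ≅ N', e ≫ s.hom = e' ∧ m ≫ n.hom = s.hom ≫ m' := by
  obtain ⟨s, ⟨hs1, hs2⟩, -⟩ := fs.fill e m e' m' (𝟙 A) n.hom he hm he' hm' (by simpa using h)
  obtain ⟨t, ⟨ht1, ht2⟩, -⟩ := fs.fill e' m' e m (𝟙 A) n.inv he' hm' he hm
    (by rw [← h]; simp)
  obtain ⟨_, -, hu⟩ := fs.fill e m e m (𝟙 A) (𝟙 B) he hm he hm (by simp)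
  obtain ⟨_, -, hu'⟩ := fs.fill e' m' e' m' (𝟙 A) (𝟙 B') he' hm' he' hm' (by simp)
  simp only [Category.id_comp] at hs1 ht1
  refine ⟨⟨s, t, ?_, ?_⟩, hs1, hs2⟩
  · rw [hu (s ≫ t) ⟨by rw [← Category.assoc, hs1, ht1]; simp, ?_⟩,
      hu (𝟙 _) ⟨by simp, by simp⟩]
    rw [Category.assoc, ← ht2, ← Category.assoc, ← hs2]; simp
  · rw [hu' (t ≫ s) ⟨by rw [← Category.assoc, ht1, hs1]; simp, ?_⟩,
      hu' (𝟙 _) ⟨by simp, by simp⟩]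
    rw [Category.assoc, ← hs2, ← Category.assoc, ← ht2]; simp

/-- `E` is closed under coproducts of morphisms. -/
lemma E_coprod [HasBinaryCoproducts C] {A B A' B' : C} {f : A ⟶ B} {g : A' ⟶ B'}
    (hf : fs.E f) (hg : fs.E g) : fs.E (coprod.map f g) := by
  have hfac := fs.e_m (coprod.map f g)
  set e := fs.e (coprod.map f g) with he
  set m := fs.m (coprod.map f g) with hm
  have hE : fs.E e := fs.e_mem _
  have hM : fs.M m := fs.m_mem _
  obtain ⟨x, ⟨hx1, hx2⟩, -⟩ := fs.fill f (𝟙 B) e m coprod.inl coprod.inl hf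
    (fs.iso_M _) hE hM (by rw [hfac]; simp)
  obtain ⟨y, ⟨hy1, hy2⟩, -⟩ := fs.fill g (𝟙 B') e m coprod.inr coprod.inr hg
    (fs.iso_M _) hE hM (by rw [hfac]; simp)
  simp only [Category.id_comp] at hx2 hy2
  have h1 : coprod.desc x y ≫ m = 𝟙 _ := by
    ext <;> simp [← hx2, ← hy2]
  have h2 : coprod.map f g ≫ coprod.desc x y = e := by
    ext <;> simp [hx1, hy1]
  obtain ⟨_, -, hu⟩ := fs.fill e m e m (𝟙 _) (𝟙 _) hE hM hE hM (by simp)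
  have h3 : m ≫ coprod.desc x y = 𝟙 _ := by
    rw [hu (m ≫ coprod.desc x y) ⟨by rw [← Category.assoc, hfac, h2]; simp,
      by rw [Category.assoc, h1]⟩, hu (𝟙 _) ⟨by simp, by simp⟩]
  have : IsIso m := ⟨⟨_, h3, h1⟩⟩
  rw [← hfac]
  exact fs.E.comp_mem _ _ hE (fs.iso_E m)

end FactorisationSystem

/-! ### Colimit facts -/

section Colimits

variable [HasFiniteColimits C]

lemma isPushout_coprod_map {A B D P A' B' D' P' : C}
    {f : A ⟶ B} {g : A ⟶ D} {j : B ⟶ P} {k : D ⟶ P}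
    {f' : A' ⟶ B'} {g' : A' ⟶ D'} {j' : B' ⟶ P'} {k' : D' ⟶ P'}
    (h : IsPushout f g j k) (h' : IsPushout f' g' j' k') :
    IsPushout (coprod.map f f') (coprod.map g g') (coprod.map j j') (coprod.map k k') := by
  refine ⟨⟨by ext <;> simp [h.w_assoc, h'.w_assoc]⟩, ⟨PushoutCocone.IsColimit.mk _
    (fun s => coprod.desc (h.desc (coprod.inl ≫ s.inl) (coprod.inl ≫ s.inr) ?_)
      (h'.desc (coprod.inr ≫ s.inl) (coprod.inr ≫ s.inr) ?_)) ?_ ?_ ?_⟩⟩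
  · have := coprod.inl ≫= s.condition
    simpa using this
  · have := coprod.inr ≫= s.condition
    simpa using this
  · intro s; ext <;> simp
  · intro s; ext <;> simp
  · intro s q hq1 hq2
    ext
    · apply h.hom_ext
      · simp [← hq1]
      · simp [← hq2]
    · apply h'.hom_ext
      · simp [← hq1]
      · simp [← hq2]

/-- A class of morphisms that is closed under composition and stable under pushout is closed under
coproducts of morphisms. -/
lemma coprod_mem (M : MorphismProperty C) [M.IsMultiplicative] [M.IsStableUnderCobaseChange]
    {A B A' B' : C} {f : A ⟶ B} {g : A' ⟶ B'} (hf : M f) (hg : M g) : M (coprod.map f g) := by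
  have h1 : M (coprod.map f (𝟙 A')) :=
    M.of_isPushout (IsPushout.of_coprod_inl_with_id f A') hf
  have h2 : M (coprod.map (𝟙 B) g) := by
    refine M.of_isPushout (f := g) (g := coprod.inr) (g' := coprod.inr) ?_ hg
    refine ⟨⟨by simp⟩, ⟨PushoutCocone.IsColimit.mk _
      (fun s => coprod.desc (coprod.inl ≫ s.inl) s.inr) ?_ ?_ ?_⟩⟩
    · intro s
      ext
      · simp
      · simp [s.condition]
    · intro s; simp
    · intro s q hq1 hq2
      ext
      · simp [← hq1]
      · simp [← hq2]
  have : coprod.map f g = coprod.map f (𝟙 A') ≫ coprod.map (𝟙 B) g := by simp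
  rw [this]
  exact M.comp_mem _ _ h1 h2

end Colimits

/-! ### The symmetric monoidal category `C ; M^op` -/

/-- A cospan `X ⟶ N ⟵ Y` whose second leg lies in `M`. -/
structure MCospan (M : MorphismProperty C) (X Y : C) where
  apex : C
  inl : X ⟶ apex
  inr : Y ⟶ apex
  mem : M inr

/-- Isomorphism of cospans. -/
def MCospan.Rel {M : MorphismProperty C} {X Y : C} (a b : MCospan M X Y) : Prop :=
  ∃ n : a.apex ≅ b.apex, a.inl ≫ n.hom = b.inl ∧ a.inr ≫ n.hom = b.inr

instance MCospan.setoid (M : MorphismProperty C) (X Y : C) : Setoid (MCospan M X Y) where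
  r := MCospan.Rel
  iseqv :=
    { refl := fun a => ⟨Iso.refl _, by simp, by simp⟩
      symm := fun ⟨n, h1, h2⟩ => ⟨n.symm, by simp [← h1], by simp [← h2]⟩
      trans := fun ⟨n, h1, h2⟩ ⟨n', h1', h2'⟩ =>
        ⟨n ≪≫ n', by simp [← h1', ← h1], by simp [← h2', ← h2]⟩ }

/-- The objects of `C ; M^op` are the objects of `C`. -/
structure CMop (M : MorphismProperty C) where
  of : C

namespace CMop

variable {M : MorphismProperty C}

/-- The morphisms of `C ; M^op` are the isomorphism classes of cospans with second leg in `M`. -/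
def Hom (X Y : CMop M) : Type (max u v) := Quotient (MCospan.setoid M X.of Y.of)

variable [HasFiniteColimits C] [M.IsMultiplicative] [M.IsStableUnderCobaseChange]

/-- Composition of cospans by pushout. -/
def compCospan {X Y Z : C} (a : MCospan M X Y) (b : MCospan M Y Z) : MCospan M X Z where
  apex := pushout a.inr b.inl
  inl := a.inl ≫ pushout.inl _ _
  inr := b.inr ≫ pushout.inr _ _
  mem := M.comp_mem _ _ b.mem
    (M.of_isPushout (IsPushout.of_hasPushout a.inr b.inl).flip a.mem)

lemma compCospan_rel {X Y Z : C} {a a' : MCospan M X Y} {b b' : MCospan M Y Z}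
    {P : C} {j : a'.apex ⟶ P} {k : b'.apex ⟶ P} (h : IsPushout a'.inr b'.inl j k)
    (hm : M (b'.inr ≫ k)) (ha : a.Rel a') (hb : b.Rel b') :
    (compCospan a b).Rel ⟨P, a'.inl ≫ j, b'.inr ≫ k, hm⟩ := by
  obtain ⟨n, h1, h2⟩ := ha
  obtain ⟨n', h1', h2'⟩ := hb
  have hp : IsPushout a.inr b.inl (n.hom ≫ j) (n'.hom ≫ k) :=
    h.of_iso (Iso.refl _) n.symm n'.symm (Iso.refl _) (by simp [← h2]) (by simp [← h1'])
      (by simp) (by simp)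
  refine ⟨(IsPushout.of_hasPushout a.inr b.inl).isoIsPushout _ _ hp, ?_, ?_⟩
  · simp [compCospan, ← h1]
  · simp [compCospan, ← h2']

instance : CategoryStruct (CMop M) where
  Hom := Hom
  id X := Quotient.mk _ ⟨X.of, 𝟙 _, 𝟙 _, M.id_mem _⟩
  comp := Quotient.map₂ compCospan (fun _ a' ha _ b' hb =>
    compCospan_rel (IsPushout.of_hasPushout a'.inr b'.inl) (compCospan a' b').mem ha hb)

/-- The morphism of `C ; M^op` given by a cospan. -/
def cls {X Y : CMop M} (a : MCospan M X.of Y.of) : X ⟶ Y := Quotient.mk _ a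

lemma cls_eq {X Y : CMop M} {a b : MCospan M X.of Y.of} (n : a.apex ≅ b.apex)
    (h1 : a.inl ≫ n.hom = b.inl) (h2 : a.inr ≫ n.hom = b.inr) :
    (cls a : X ⟶ Y) = cls b :=
  Quotient.sound ⟨n, h1, h2⟩

lemma id_eq (X : CMop M) : 𝟙 X = cls ⟨X.of, 𝟙 _, 𝟙 _, M.id_mem _⟩ := rfl

lemma ind {X Y : CMop M} {p : (X ⟶ Y) → Prop} (h : ∀ a : MCospan M X.of Y.of, p (cls a))
    (f : X ⟶ Y) : p f := Quotient.ind h f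

/-- The composite can be computed with any pushout. -/
lemma cls_comp_cls {X Y Z : CMop M} (a : MCospan M X.of Y.of) (b : MCospan M Y.of Z.of)
    {P : C} {j : a.apex ⟶ P} {k : b.apex ⟶ P} (h : IsPushout a.inr b.inl j k)
    (hm : M (b.inr ≫ k)) :
    (cls a : X ⟶ Y) ≫ (cls b : Y ⟶ Z) = cls ⟨P, a.inl ≫ j, b.inr ≫ k, hm⟩ :=
  Quotient.sound (compCospan_rel h hm (Setoid.refl a) (Setoid.refl b))

instance : Category (CMop M) where
  id_comp {X Y} f := by
    induction f using ind with | _ a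
    exact (cls_comp_cls (X := X) (Y := X) (Z := Y) ⟨X.of, 𝟙 _, 𝟙 _, M.id_mem _⟩ a
      (j := a.inl) (k := 𝟙 _) IsPushout.of_id_fst (by simpa using a.mem)).trans
      (cls_eq (Iso.refl _) (by simp) (by simp))
  comp_id {X Y} f := by
    induction f using ind with | _ a
    exact (cls_comp_cls (X := X) (Y := Y) (Z := Y) a ⟨Y.of, 𝟙 _, 𝟙 _, M.id_mem _⟩
      (j := 𝟙 _) (k := a.inr) IsPushout.of_id_snd (by simpa using a.mem)).trans
      (cls_eq (Iso.refl _) (by simp) (by simp))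
  assoc {W X Y Z} f g h := by
    induction f using ind with | _ a
    induction g using ind with | _ b
    induction h using ind with | _ c
    have hT := IsPushout.of_hasPushout (pushout.inr a.inr b.inl) (pushout.inl b.inr c.inl)
    have hP := IsPushout.of_hasPushout a.inr b.inl
    have hQ := IsPushout.of_hasPushout b.inr c.inl
    have hl := hQ.paste_horiz hT
    have hr := hP.paste_vert hT
    rw [cls_comp_cls a b hP (compCospan a b).mem, cls_comp_cls b c hQ (compCospan b c).mem]
    have hmem : M (c.inr ≫ pushout.inr b.inr c.inl ≫
        pushout.inr (pushout.inr a.inr b.inl) (pushout.inl b.inr c.inl)) :=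
      M.comp_mem _ _ c.mem (M.of_isPushout hl.flip (compCospan a b).mem)
    refine (cls_comp_cls (X := W) (Y := Y) (Z := Z) (compCospan a b) c hl hmem).trans ?_
    refine Eq.trans ?_ (cls_comp_cls (X := W) (Y := X) (Z := Z) a (compCospan b c) hr
      (by simpa [compCospan] using hmem)).symm
    exact cls_eq (Iso.refl _) (by simp [compCospan]) (by simp [compCospan])

/-- A morphism `f : X ⟶ Y` of `C`, regarded as the cospan `X ⟶ Y = Y`. -/
def fwd {X Y : C} (f : X ⟶ Y) : (⟨X⟩ : CMop M) ⟶ ⟨Y⟩ := cls ⟨Y, f, 𝟙 _, M.id_mem _⟩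

/-- A morphism `m : X ⟶ Y` in `M`, regarded as the cospan `Y = Y ⟵ X`; this is `m^op`. -/
def bwd {X Y : C} (m : X ⟶ Y) (hm : M m) : (⟨Y⟩ : CMop M) ⟶ ⟨X⟩ := cls ⟨Y, 𝟙 _, m, hm⟩

lemma fwd_comp_cls {X Y Z : C} (f : X ⟶ Y) (a : MCospan M Y Z) :
    (fwd f : (⟨X⟩ : CMop M) ⟶ ⟨Y⟩) ≫ (cls a : _ ⟶ ⟨Z⟩) =
      cls ⟨a.apex, f ≫ a.inl, a.inr, a.mem⟩ :=
  (cls_comp_cls (X := ⟨X⟩) (Y := ⟨Y⟩) (Z := ⟨Z⟩) ⟨Y, f, 𝟙 _, M.id_mem _⟩ a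
    (j := a.inl) (k := 𝟙 _) IsPushout.of_id_fst (by simpa using a.mem)).trans
    (cls_eq (Iso.refl _) (by simp) (by simp))

lemma cls_comp_fwd_iso {X Y Z : C} (a : MCospan M X Y) (f : Y ≅ Z)
    (hm : M (f.inv ≫ a.inr)) :
    (cls a : (⟨X⟩ : CMop M) ⟶ ⟨Y⟩) ≫ fwd f.hom = cls ⟨a.apex, a.inl, f.inv ≫ a.inr, hm⟩ :=
  (cls_comp_cls (X := ⟨X⟩) (Y := ⟨Y⟩) (Z := ⟨Z⟩) a ⟨Z, f.hom, 𝟙 _, M.id_mem _⟩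
    (j := 𝟙 _) (k := f.inv ≫ a.inr) (IsPushout.of_vert_isIso ⟨by simp⟩) (by simpa using hm)).trans
    (cls_eq (Iso.refl _) (by simp) (by simp))

/-- Naturality of an isomorphism of `C` with respect to cospans. -/
lemma naturality {X Y X' Y' : C} (a : MCospan M X Y) (b : MCospan M X' Y') (n : a.apex ≅ b.apex)
    (f : X ⟶ X') (g : Y ≅ Y') (h1 : a.inl ≫ n.hom = f ≫ b.inl)
    (h2 : a.inr ≫ n.hom = g.hom ≫ b.inr) :
    (cls a : (⟨X⟩ : CMop M) ⟶ ⟨Y⟩) ≫ fwd g.hom = fwd f ≫ (cls b : _ ⟶ ⟨Y'⟩) := by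
  have e : g.inv ≫ a.inr = b.inr ≫ n.inv := by
    rw [Iso.inv_comp_eq, ← Category.assoc, ← h2]; simp
  have hm : M (g.inv ≫ a.inr) := by
    rw [e]; exact (M.cancel_right_of_respectsIso _ _).2 b.mem
  rw [cls_comp_fwd_iso a g hm, fwd_comp_cls]
  exact cls_eq n h1 (by simp [e])

lemma fwd_comp {X Y Z : C} (f : X ⟶ Y) (g : Y ⟶ Z) :
    (fwd f : (⟨X⟩ : CMop M) ⟶ ⟨Y⟩) ≫ fwd g = fwd (f ≫ g) := fwd_comp_cls _ _

lemma fwd_id (X : C) : (fwd (𝟙 X) : (⟨X⟩ : CMop M) ⟶ ⟨X⟩) = 𝟙 _ := rfl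

/-- An isomorphism of `C`, regarded as an isomorphism of `C ; M^op`. -/
@[simps]
def fwdIso {X Y : C} (f : X ≅ Y) : (⟨X⟩ : CMop M) ≅ ⟨Y⟩ where
  hom := fwd f.hom
  inv := fwd f.inv
  hom_inv_id := by rw [fwd_comp, f.hom_inv_id, fwd_id]
  inv_hom_id := by rw [fwd_comp, f.inv_hom_id, fwd_id]

/-- The coproduct of two cospans. -/
def tensorCospan {X Y X' Y' : C} (a : MCospan M X Y) (b : MCospan M X' Y') :
    MCospan M (X ⨿ X') (Y ⨿ Y') where
  apex := a.apex ⨿ b.apex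
  inl := coprod.map a.inl b.inl
  inr := coprod.map a.inr b.inr
  mem := coprod_mem M a.mem b.mem

/-- The monoidal product of morphisms of `C ; M^op`. -/
def tensor {X Y X' Y' : CMop M} : (X ⟶ Y) → (X' ⟶ Y') →
    ((⟨X.of ⨿ X'.of⟩ : CMop M) ⟶ ⟨Y.of ⨿ Y'.of⟩) :=
  Quotient.map₂ tensorCospan (fun _ _ ⟨n, h1, h2⟩ _ _ ⟨n', h1', h2'⟩ =>
    ⟨coprod.mapIso n n', by simp [tensorCospan, h1, h1'], by simp [tensorCospan, h2, h2']⟩)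

lemma tensor_cls {X Y X' Y' : CMop M} (a : MCospan M X.of Y.of) (b : MCospan M X'.of Y'.of) :
    tensor (cls a : X ⟶ Y) (cls b : X' ⟶ Y') = cls (tensorCospan a b) := rfl

lemma tensor_fwd {X Y X' Y' : C} (f : X ⟶ Y) (g : X' ⟶ Y') :
    tensor (fwd f : (⟨X⟩ : CMop M) ⟶ ⟨Y⟩) (fwd g : (⟨X'⟩ : CMop M) ⟶ ⟨Y'⟩) =
      fwd (coprod.map f g) :=
  cls_eq (Iso.refl _) (by simp [tensorCospan]) (by simp [tensorCospan])

instance : MonoidalCategoryStruct (CMop M) where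
  tensorObj X Y := ⟨X.of ⨿ Y.of⟩
  tensorHom f g := tensor f g
  whiskerLeft X _ _ g := tensor (𝟙 X) g
  whiskerRight f Y := tensor f (𝟙 Y)
  tensorUnit := ⟨⊥_ C⟩
  associator X Y Z := fwdIso (coprod.associator X.of Y.of Z.of)
  leftUnitor X := fwdIso (coprod.leftUnitor X.of)
  rightUnitor X := fwdIso (coprod.rightUnitor X.of)

lemma tensor_comp {X Y Z X' Y' Z' : CMop M} (f : X ⟶ Y) (f' : X' ⟶ Y') (g : Y ⟶ Z)
    (g' : Y' ⟶ Z') : tensor f f' ≫ tensor g g' = tensor (f ≫ g) (f' ≫ g') := by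
  induction f using ind with | _ a
  induction f' using ind with | _ a'
  induction g using ind with | _ b
  induction g' using ind with | _ b'
  have h := IsPushout.of_hasPushout a.inr b.inl
  have h' := IsPushout.of_hasPushout a'.inr b'.inl
  rw [cls_comp_cls a b h (compCospan a b).mem, cls_comp_cls a' b' h' (compCospan a' b').mem]
  simp only [tensor_cls]
  refine (cls_comp_cls _ _ (isPushout_coprod_map h h') ?_).trans
    (cls_eq (Iso.refl _) (by simp [tensorCospan]) (by simp [tensorCospan]))
  have := coprod_mem M (compCospan a b).mem (compCospan a' b').mem
  simpa [tensorCospan, compCospan] using this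

/-- `C ; M^op` is monoidal under the coproduct of `C`. -/
instance : MonoidalCategory (CMop M) :=
  MonoidalCategory.ofTensorHom
    (id_tensorHom_id := fun X Y => (tensor_fwd (𝟙 X.of) (𝟙 Y.of)).trans (by
      rw [coprod.map_id_id]; rfl))
    (id_tensorHom := fun _ _ _ _ => rfl)
    (tensorHom_id := fun _ _ => rfl)
    (tensorHom_comp_tensorHom := fun f f' g g' => tensor_comp f f' g g')
    (associator_naturality := fun {X₁ X₂ X₃ Y₁ Y₂ Y₃} f g h => by
      induction f using ind with | _ a
      induction g using ind with | _ b
      induction h using ind with | _ c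
      exact naturality (tensorCospan (tensorCospan a b) c) (tensorCospan a (tensorCospan b c))
        (coprod.associator _ _ _) (coprod.associator _ _ _).hom (coprod.associator _ _ _)
        (coprod.associator_naturality _ _ _) (coprod.associator_naturality _ _ _))
    (leftUnitor_naturality := fun {X Y} f => by
      induction f using ind with | _ a
      exact naturality (tensorCospan ⟨_, 𝟙 _, 𝟙 _, M.id_mem _⟩ a) a
        (coprod.leftUnitor _) (coprod.leftUnitor _).hom (coprod.leftUnitor _)
        (coprod.leftUnitor_naturality _) (coprod.leftUnitor_naturality _))
    (rightUnitor_naturality := fun {X Y} f => by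
      induction f using ind with | _ a
      exact naturality (tensorCospan a ⟨_, 𝟙 _, 𝟙 _, M.id_mem _⟩) a
        (coprod.rightUnitor _) (coprod.rightUnitor _).hom (coprod.rightUnitor _)
        (coprod.rightUnitor_naturality _) (coprod.rightUnitor_naturality _))
    (pentagon := fun W X Y Z => by
      change tensor (fwd _) (fwd (𝟙 _)) ≫ fwd _ ≫ tensor (fwd (𝟙 _)) (fwd _) = fwd _ ≫ fwd _
      simp only [tensor_fwd, fwd_comp]
      exact congrArg fwd (coprod.pentagon _ _ _ _))
    (triangle := fun X Y => by
      change fwd _ ≫ tensor (fwd (𝟙 _)) (fwd _) = tensor (fwd _) (fwd (𝟙 _))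
      simp only [tensor_fwd, fwd_comp]
      exact congrArg fwd (coprod.triangle _ _))

attribute [local instance] monoidalOfHasFiniteCoproducts symmetricOfHasFiniteCoproducts in
lemma hexagons (X Y Z : C) :
    (coprod.associator X Y Z).hom ≫ (coprod.braiding X (Y ⨿ Z)).hom ≫
      (coprod.associator Y Z X).hom = coprod.map (coprod.braiding X Y).hom (𝟙 Z) ≫
      (coprod.associator Y X Z).hom ≫ coprod.map (𝟙 Y) (coprod.braiding X Z).hom ∧
    (coprod.associator X Y Z).inv ≫ (coprod.braiding (X ⨿ Y) Z).hom ≫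
      (coprod.associator Z X Y).inv = coprod.map (𝟙 X) (coprod.braiding Y Z).hom ≫
      (coprod.associator X Z Y).inv ≫ coprod.map (coprod.braiding X Z).hom (𝟙 Y) :=
  ⟨BraidedCategory.hexagon_forward X Y Z, BraidedCategory.hexagon_reverse X Y Z⟩

lemma braiding_naturality {X Y X' Y' : CMop M} (f : X ⟶ Y) (g : X' ⟶ Y') :
    tensor f g ≫ fwd (coprod.braiding Y.of Y'.of).hom =
      fwd (coprod.braiding X.of X'.of).hom ≫ tensor g f := by
  induction f using ind with | _ a
  induction g using ind with | _ b
  exact naturality (tensorCospan a b) (tensorCospan b a) (coprod.braiding _ _)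
    (coprod.braiding _ _).hom (coprod.braiding _ _)
    (by simp [tensorCospan]) (by simp [tensorCospan])

/-- The braiding of `C ; M^op` is that of `C`. -/
instance : SymmetricCategory (CMop M) where
  braiding X Y := fwdIso (coprod.braiding X.of Y.of)
  braiding_naturality_right X _ _ f := braiding_naturality (𝟙 X) f
  braiding_naturality_left f Z := braiding_naturality f (𝟙 Z)
  hexagon_forward X Y Z := by
    change fwd _ ≫ fwd _ ≫ fwd _ = tensor (fwd _) (fwd (𝟙 _)) ≫ fwd _ ≫ tensor (fwd (𝟙 _)) (fwd _)
    simp only [tensor_fwd, fwd_comp]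
    exact congrArg fwd (hexagons _ _ _).1
  hexagon_reverse X Y Z := by
    change fwd _ ≫ fwd _ ≫ fwd _ = tensor (fwd (𝟙 _)) (fwd _) ≫ fwd _ ≫ tensor (fwd _) (fwd (𝟙 _))
    simp only [tensor_fwd, fwd_comp]
    exact congrArg fwd (hexagons _ _ _).2
  symmetry X Y := by
    change fwd _ ≫ fwd _ = 𝟙 _
    rw [fwd_comp, coprod.symmetry]
    rfl

end CMop

/-! ### Decorated cospans and decorated corelations -/

variable [HasFiniteColimits C] {fs : FactorisationSystem C} [fs.Costable]

/-- An `F`-decorated cospan `X ⟶ N ⟵ Y`, with decoration an element of `F N`. -/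
structure DecCospan (F : CMop fs.M ⥤ Type w) (X Y : C) where
  apex : C
  inl : X ⟶ apex
  inr : Y ⟶ apex
  dec : F.obj ⟨apex⟩

/-- An `F`-decorated corelation: a decorated cospan that is jointly `E`-like. -/
structure DecCorel (F : CMop fs.M ⥤ Type w) (X Y : C) extends DecCospan F X Y where
  jointly_E : fs.E (coprod.desc inl inr)

variable {F : CMop fs.M ⥤ Type w}

/-- The function `F f : F N ⟶ F N'` on elements, for a morphism `f` of `C`. -/
def push (F : CMop fs.M ⥤ Type w) {N N' : C} (f : N ⟶ N') (s : F.obj ⟨N⟩) : F.obj ⟨N'⟩ :=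
  F.map (CMop.fwd f) s

/-- The function `F (m^op) : F N' ⟶ F N` on elements, for a morphism `m : N ⟶ N'` in `M`. -/
def pull (F : CMop fs.M ⥤ Type w) {N N' : C} (m : N ⟶ N') (hm : fs.M m) (s : F.obj ⟨N'⟩) :
    F.obj ⟨N⟩ :=
  F.map (CMop.bwd m hm) s

/-- The laxity map `φ_{N,N'} : F N × F N' ⟶ F (N + N')` on elements. -/
def lax (F : CMop fs.M ⥤ Type w) [F.LaxMonoidal] {N N' : C} (s : F.obj ⟨N⟩) (t : F.obj ⟨N'⟩) :
    F.obj ⟨N ⨿ N'⟩ :=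
  (Functor.LaxMonoidal.μ F (⟨N⟩ : CMop fs.M) (⟨N'⟩ : CMop fs.M) :
    F.obj ⟨N⟩ ⊗ F.obj ⟨N'⟩ ⟶ F.obj ⟨N ⨿ N'⟩) ((s, t) : F.obj ⟨N⟩ × F.obj ⟨N'⟩)

/-- The empty decoration `1 ⟶ F ∅ ⟶ F N`. -/
def emptyDec (F : CMop fs.M ⥤ Type w) [F.LaxMonoidal] (N : C) : F.obj ⟨N⟩ :=
  push F (initial.to N)
    ((Functor.LaxMonoidal.ε F : PUnit.{w + 1} ⟶ F.obj ⟨⊥_ C⟩) PUnit.unit)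

lemma push_id {N : C} (s : F.obj ⟨N⟩) : push F (𝟙 N) s = s := by
  simp [push, CMop.fwd_id]

lemma push_push {N N' N'' : C} (f : N ⟶ N') (g : N' ⟶ N'') (s : F.obj ⟨N⟩) :
    push F g (push F f s) = push F (f ≫ g) s := by
  simp only [push, ← CMop.fwd_comp, Functor.map_comp_apply]

lemma push_pull {N B N' B' : C} {m : N ⟶ B} {m' : N' ⟶ B'} (hm : fs.M m) (hm' : fs.M m')
    (n : B ≅ B') (s : N ≅ N') (h : m ≫ n.hom = s.hom ≫ m') (x : F.obj ⟨B⟩) :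
    push F s.hom (pull F m hm x) = pull F m' hm' (push F n.hom x) := by
  have e : (CMop.bwd m hm ≫ CMop.fwd s.hom : (⟨B⟩ : CMop fs.M) ⟶ ⟨N'⟩) =
      CMop.fwd n.hom ≫ CMop.bwd m' hm' :=
    CMop.naturality ⟨_, 𝟙 _, _, hm⟩ ⟨_, 𝟙 _, _, hm'⟩ n n.hom s (by simp) h
  simp only [push, pull, ← Functor.map_comp_apply, e]

lemma push_lax [F.LaxMonoidal] {N M N' M' : C} (f : N ⟶ N') (g : M ⟶ M') (s : F.obj ⟨N⟩)
    (t : F.obj ⟨M⟩) :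
    push F (coprod.map f g) (lax F s t) = lax F (push F f s) (push F g t) := by
  have h := Functor.LaxMonoidal.μ_natural F
    (CMop.fwd f : (⟨N⟩ : CMop fs.M) ⟶ ⟨N'⟩) (CMop.fwd g : (⟨M⟩ : CMop fs.M) ⟶ ⟨M'⟩)
  unfold push
  rw [← CMop.tensor_fwd]
  exact (ConcreteCategory.congr_hom h ((s, t) : F.obj ⟨N⟩ × F.obj ⟨M⟩)).symm

namespace DecCospan

/-- Isomorphism of decorated cospans: an isomorphism of cospans that carries one decoration to the
other. -/
def Rel {X Y : C} (a b : DecCospan F X Y) : Prop :=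
  ∃ n : a.apex ≅ b.apex, a.inl ≫ n.hom = b.inl ∧ a.inr ≫ n.hom = b.inr ∧
    push F n.hom a.dec = b.dec

lemma Rel.refl {X Y : C} (a : DecCospan F X Y) : a.Rel a :=
  ⟨Iso.refl _, by simp, by simp, push_id _⟩

lemma Rel.symm {X Y : C} {a b : DecCospan F X Y} : a.Rel b → b.Rel a := by
  rintro ⟨n, h1, h2, h3⟩
  refine ⟨n.symm, by simp [← h1], by simp [← h2], ?_⟩
  rw [← h3, push_push]
  simp [push_id]

lemma Rel.trans {X Y : C} {a b c : DecCospan F X Y} : a.Rel b → b.Rel c → a.Rel c := by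
  rintro ⟨n, h1, h2, h3⟩ ⟨n', h1', h2', h3'⟩
  refine ⟨n ≪≫ n', by simp [← h1', ← h1], by simp [← h2', ← h2], ?_⟩
  rw [← h3', ← h3, push_push]
  simp

/-- The `E`-part of a decorated cospan, with the restricted decoration `F(m^op)(s)`, where `m` is
the `M`-factor of the copairing of the cospan. -/
def restrict {X Y : C} (a : DecCospan F X Y) : DecCorel F X Y where
  apex := fs.mid (coprod.desc a.inl a.inr)
  inl := coprod.inl ≫ fs.e (coprod.desc a.inl a.inr)
  inr := coprod.inr ≫ fs.e (coprod.desc a.inl a.inr)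
  dec := pull F (fs.m (coprod.desc a.inl a.inr)) (fs.m_mem _) a.dec
  jointly_E := by
    convert fs.e_mem (coprod.desc a.inl a.inr)
    ext <;> simp

lemma restrict_rel {X Y : C} {a b : DecCospan F X Y} :
    a.Rel b → a.restrict.toDecCospan.Rel b.restrict.toDecCospan := by
  rintro ⟨n, h1, h2, h3⟩
  obtain ⟨s, hs1, hs2⟩ := fs.exists_iso n (fs.e_mem (coprod.desc a.inl a.inr)) (fs.m_mem _)
    (fs.e_mem (coprod.desc b.inl b.inr)) (fs.m_mem _)
    (by rw [fs.e_m, fs.e_m]; ext <;> simp [h1, h2])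
  refine ⟨s, by simp [restrict, hs1], by simp [restrict, hs1], ?_⟩
  have := push_pull (F := F) (fs.m_mem _) (fs.m_mem _) n s hs2 a.dec
  rw [h3] at this
  exact this

variable [F.LaxMonoidal]

/-- The composite decorated cospan: the pushout of the cospans, decorated with
`F[j_N, j_M] (φ_{N,M} (s, t))`. -/
def comp {X Y Z : C} (a : DecCospan F X Y) (b : DecCospan F Y Z) : DecCospan F X Z where
  apex := pushout a.inr b.inl
  inl := a.inl ≫ pushout.inl a.inr b.inl
  inr := b.inr ≫ pushout.inr a.inr b.inl
  dec := push F (coprod.desc (pushout.inl a.inr b.inl) (pushout.inr a.inr b.inl))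
    (lax F a.dec b.dec)

/-- The monoidal product of decorated cospans: the coproduct of the cospans, decorated with
`φ_{N,M} (s, t)`. -/
def tensor {X Y X' Y' : C} (a : DecCospan F X Y) (b : DecCospan F X' Y') :
    DecCospan F (X ⨿ X') (Y ⨿ Y') where
  apex := a.apex ⨿ b.apex
  inl := coprod.map a.inl b.inl
  inr := coprod.map a.inr b.inr
  dec := lax F a.dec b.dec

/-- The cospan `X ⟶ N ⟵ Y` with the empty decoration. -/
def empty (F : CMop fs.M ⥤ Type w) [F.LaxMonoidal] {X Y N : C} (i : X ⟶ N) (o : Y ⟶ N) :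
    DecCospan F X Y where
  apex := N
  inl := i
  inr := o
  dec := emptyDec F N

lemma tensor_rel {X Y X' Y' : C} {a b : DecCospan F X Y} {a' b' : DecCospan F X' Y'} :
    a.Rel b → a'.Rel b' → (a.tensor a').Rel (b.tensor b') := by
  rintro ⟨n, h1, h2, h3⟩ ⟨n', h1', h2', h3'⟩
  refine ⟨coprod.mapIso n n', by simp [tensor, h1, h1'], by simp [tensor, h2, h2'], ?_⟩
  refine (push_lax n.hom n'.hom a.dec a'.dec).trans ?_
  rw [h3, h3']
  rfl

lemma comp_rel {X Y Z : C} {a b : DecCospan F X Y} {a' b' : DecCospan F Y Z} :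
    a.Rel b → a'.Rel b' → (a.comp a').Rel (b.comp b') := by
  rintro ⟨n, h1, h2, h3⟩ ⟨n', h1', h2', h3'⟩
  have hb := IsPushout.of_hasPushout b.inr b'.inl
  have hp : IsPushout a.inr a'.inl (n.hom ≫ pushout.inl b.inr b'.inl)
      (n'.hom ≫ pushout.inr b.inr b'.inl) :=
    hb.of_iso (Iso.refl _) n.symm n'.symm (Iso.refl _) (by simp [← h2]) (by simp [← h1'])
      (by simp) (by simp)
  have key : coprod.desc (pushout.inl a.inr a'.inl) (pushout.inr a.inr a'.inl) ≫
      ((IsPushout.of_hasPushout a.inr a'.inl).isoIsPushout _ _ hp).hom =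
      coprod.map n.hom n'.hom ≫
        coprod.desc (pushout.inl b.inr b'.inl) (pushout.inr b.inr b'.inl) := by
    ext <;> simp
  refine ⟨(IsPushout.of_hasPushout a.inr a'.inl).isoIsPushout _ _ hp, by simp [comp, ← h1],
    by simp [comp, ← h2'], ?_⟩
  refine (push_push _ _ _).trans ?_
  refine Eq.trans ?_ (congrArg (push F _) (congrArg₂ (lax F) h3 h3'))
  rw [← push_lax]
  refine Eq.trans ?_ (push_push _ _ _).symm
  exact congrArg (fun f => push F f (lax F a.dec a'.dec)) key

end DecCospan

namespace DecCorel

instance setoid (F : CMop fs.M ⥤ Type w) (X Y : C) : Setoid (DecCorel F X Y) where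
  r a b := a.toDecCospan.Rel b.toDecCospan
  iseqv := ⟨fun _ => .refl _, .symm, .trans⟩

/-- The interchange `(X + X') + (Y + Y') ≅ (X + Y) + (X' + Y')`. -/
def interchange (X X' Y Y' : C) : (X ⨿ X') ⨿ (Y ⨿ Y') ≅ (X ⨿ Y) ⨿ (X' ⨿ Y') where
  hom := coprod.desc (coprod.map coprod.inl coprod.inl) (coprod.map coprod.inr coprod.inr)
  inv := coprod.desc (coprod.map coprod.inl coprod.inl) (coprod.map coprod.inr coprod.inr)
  hom_inv_id := by ext <;> simp
  inv_hom_id := by ext <;> simp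

variable [F.LaxMonoidal]

/-- The monoidal product of decorated corelations is their monoidal product as decorated
cospans. -/
def tensor {X Y X' Y' : C} (a : DecCorel F X Y) (b : DecCorel F X' Y') :
    DecCorel F (X ⨿ X') (Y ⨿ Y') where
  toDecCospan := a.toDecCospan.tensor b.toDecCospan
  jointly_E := by
    have h := fs.E.comp_mem _ _ (fs.iso_E (interchange X X' Y Y').hom)
      (fs.E_coprod a.jointly_E b.jointly_E)
    have e : (interchange X X' Y Y').hom ≫
        coprod.map (coprod.desc a.inl a.inr) (coprod.desc b.inl b.inr) =
        coprod.desc (coprod.map a.inl b.inl) (coprod.map a.inr b.inr) := by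
      ext <;> simp [interchange]
    rw [e] at h
    exact h

end DecCorel

/-! ### The operations of `FCorel` -/

/-- The objects of `FCorel` are the objects of `C`. -/
structure FCorel (F : CMop fs.M ⥤ Type w) where
  of : C

namespace FCorel

/-- The morphisms of `FCorel` are the isomorphism classes of `F`-decorated corelations. -/
def Hom (X Y : FCorel F) : Type (max u v w) :=
  Quotient (DecCorel.setoid F X.of Y.of)

/-- The class of the `E`-part of a decorated cospan with the restricted decoration. -/
def square {X Y : FCorel F} (a : DecCospan F X.of Y.of) : Hom X Y :=
  Quotient.mk _ a.restrict

variable (F) [F.LaxMonoidal]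

/-- The operations of `FCorel`.  Composition is the `E`-part of the pushout with restricted
decoration, the monoidal product is the coproduct, and the identities, the coherence maps and the
Frobenius maps are those of the category of cospans in `C`, with restricted empty decoration. -/
def data : HypergraphData.{max u v w} (FCorel F) where
  Hom X Y := Hom X Y
  id X := square (DecCospan.empty F (𝟙 X.of) (𝟙 X.of))
  comp := Quotient.map₂ (fun a b => (a.toDecCospan.comp b.toDecCospan).restrict)
    (fun _ _ h _ _ h' => DecCospan.restrict_rel (DecCospan.comp_rel h h'))
  tensorObj X Y := ⟨X.of ⨿ Y.of⟩
  tensorHom := Quotient.map₂ DecCorel.tensor (fun _ _ h _ _ h' => DecCospan.tensor_rel h h')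
  tensorUnit := ⟨⊥_ C⟩
  associator X Y Z := square (DecCospan.empty F (coprod.associator X.of Y.of Z.of).hom (𝟙 _))
  leftUnitor X := square (DecCospan.empty F (coprod.leftUnitor X.of).hom (𝟙 _))
  rightUnitor X := square (DecCospan.empty F (coprod.rightUnitor X.of).hom (𝟙 _))
  braiding X Y := square (DecCospan.empty F (coprod.braiding X.of Y.of).hom (𝟙 _))
  mul X := square (DecCospan.empty F (codiag X.of) (𝟙 X.of))
  one X := square (DecCospan.empty F (initial.to X.of) (𝟙 X.of))
  comul X := square (DecCospan.empty F (𝟙 X.of) (codiag X.of))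
  counit X := square (DecCospan.empty F (𝟙 X.of) (initial.to X.of))

end FCorel

end DecoratedCorelation

end

/-! Decorated cospans satisfy all the required laws up to isomorphism: cospans compose by pushout,
and the coherence of `φ` handles the decorations. The point is that these laws survive restriction
to corelations, which follows once `□` respects composition and monoidal product.

For composition, let `m : N̄ ⟶ N` and `m' : M̄ ⟶ M` be the `M`-factors of two cospans glued over
`Y`. The induced map `t : N̄ +_Y M̄ ⟶ N +_Y M` is the pushout of `m + m'` along the quotient map `N̄
+ M̄ ⟶ N̄ +_Y M̄` (`isPushout_desc_map`), so costability puts `t` in `M`. Read in `C ; M^op`, the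
same square says that restricting along `m + m'` and then pushing to the quotient equals pushing and
then restricting along `t` (`push_pull_of_isPushout`). With naturality of `φ` (`pull_lax`), the
composite of the restrictions is thus the composite restricted along a map in `M`, which a further
restriction does not detect (`restrict_rel_of_mem`). This is `restrict_comp_restrict`; the monoidal
case uses `m + m'` directly.

Every morphism can then be represented by an arbitrary decorated cospan and computed before
restricting. The structure maps are images `fwd f` and `bwd f` of morphisms of `C`, so coherence and
(co)monoid laws are identities in `C`, while the special and Frobenius laws come from pushout
squares through `bwd_comp_fwd`. -/

noncomputable section

namespace DecoratedCorelation

attribute [local simp] coprod.inl_desc coprod.inr_desc coprod.inl_desc_assoc coprod.inr_desc_assoc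

variable {C : Type u} [Category.{v} C] [HasFiniteColimits C]

/-! ### Colimit facts -/

/-- The quotient maps `N + M ⟶ N +_Y M` form a pushout square under a change of `N` and `M`. -/
lemma isPushout_desc_map {Y N M P N' M' P' : C} {o : Y ⟶ N} {i : Y ⟶ M} {j : N ⟶ P} {k : M ⟶ P}
    {m : N ⟶ N'} {m' : M ⟶ M'} {j' : N' ⟶ P'} {k' : M' ⟶ P'} {t : P ⟶ P'}
    (h : IsPushout o i j k) (h' : IsPushout (o ≫ m) (i ≫ m') j' k')
    (ht : j ≫ t = m ≫ j') (ht' : k ≫ t = m' ≫ k') :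
    IsPushout (coprod.desc j k) (coprod.map m m') t (coprod.desc j' k') := by
  refine ⟨⟨by ext <;> simp [ht, ht']⟩, ⟨PushoutCocone.IsColimit.mk _
    (fun s => h'.desc (coprod.inl ≫ s.inr) (coprod.inr ≫ s.inr) ?_) ?_ ?_ ?_⟩⟩
  -- The two maps out of `N'` and `M'` agree on `Y`: restricted to `N` and `M` they factor through
  -- `P`, where `o` and `i` are already identified.
  · have h1 := coprod.inl ≫= s.condition
    have h2 := coprod.inr ≫= s.condition
    simp only [coprod.inl_desc_assoc, coprod.inr_desc_assoc, coprod.inl_map_assoc,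
      coprod.inr_map_assoc] at h1 h2
    simp only [Category.assoc, ← h1, ← h2, h.w_assoc]
  · intro s
    have h1 := coprod.inl ≫= s.condition
    have h2 := coprod.inr ≫= s.condition
    simp only [coprod.inl_desc_assoc, coprod.inr_desc_assoc, coprod.inl_map_assoc,
      coprod.inr_map_assoc] at h1 h2
    apply h.hom_ext
    · rw [reassoc_of% ht]; simp [h1]
    · rw [reassoc_of% ht']; simp [h2]
  · intro s; ext <;> simp
  · intro s q hq1 hq2
    apply h'.hom_ext <;> simp [← hq2]

/-- The codiagonal is an epimorphism, so that it is its own cokernel pair. -/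
lemma isPushout_codiag (X : C) : IsPushout (codiag X) (codiag X) (𝟙 X) (𝟙 X) := by
  refine ⟨⟨rfl⟩, ⟨PushoutCocone.IsColimit.mk _ (fun s => s.inl) (by simp) ?_ ?_⟩⟩
  · intro s
    have := coprod.inl ≫= s.condition
    simpa using this
  · intro s q hq1 _
    simpa using hq1

/-- The square behind the Frobenius law. -/
lemma isPushout_frobenius (X : C) :
    IsPushout (coprod.map (codiag X) (𝟙 X))
      ((coprod.associator X X X).hom ≫ coprod.map (𝟙 X) (codiag X)) (codiag X) (codiag X) := by
  refine ⟨⟨by ext <;> simp⟩, ⟨PushoutCocone.IsColimit.mk _ (fun s => coprod.inl ≫ s.inl) ?_ ?_ ?_⟩⟩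
  -- The second summand of `(X + X) + X` lies in a fold on both sides, so it links the first
  -- component of `s.inl` to the second of `s.inr`. The outer summands then force all four
  -- components to coincide.
  · intro s
    have h2 := coprod.inr ≫= coprod.inl ≫= s.condition
    have h3 := coprod.inr ≫= s.condition
    simp at h2 h3
    ext <;> simp [h2, h3]
  · intro s
    have h1 := coprod.inl ≫= coprod.inl ≫= s.condition
    have h2 := coprod.inr ≫= coprod.inl ≫= s.condition
    simp at h1 h2
    ext <;> simp [h1, ← h2]
  · intro s q hq1 _
    simp [← hq1]

/-- The mirror image of `isPushout_frobenius`. -/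
lemma isPushout_frobenius' (X : C) :
    IsPushout (coprod.map (𝟙 X) (codiag X))
      ((coprod.associator X X X).inv ≫ coprod.map (codiag X) (𝟙 X)) (codiag X) (codiag X) :=
  (isPushout_frobenius X).flip.of_iso (coprod.associator X X X) (Iso.refl _) (Iso.refl _)
    (Iso.refl _) (by simp) (by ext <;> simp) (by simp) (by simp)

/-! ### Decorations -/

variable {fs : FactorisationSystem C} [fs.Costable] {F : CMop fs.M ⥤ Type w}

lemma pull_pull {A B D : C} (m : A ⟶ B) (m' : B ⟶ D) (hm : fs.M m) (hm' : fs.M m')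
    (s : F.obj ⟨D⟩) :
    pull F m hm (pull F m' hm' s) = pull F (m ≫ m') (fs.M.comp_mem _ _ hm hm') s := by
  have e : (CMop.bwd m' hm' ≫ CMop.bwd m hm : (⟨D⟩ : CMop fs.M) ⟶ ⟨A⟩) =
      CMop.bwd (m ≫ m') (fs.M.comp_mem _ _ hm hm') :=
    (CMop.cls_comp_cls (X := ⟨D⟩) (Y := ⟨B⟩) (Z := ⟨A⟩) ⟨D, 𝟙 _, m', hm'⟩ ⟨B, 𝟙 _, m, hm⟩
      (j := 𝟙 _) (k := m') IsPushout.of_id_snd (fs.M.comp_mem _ _ hm hm')).trans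
      (CMop.cls_eq (Iso.refl _) (by simp) (by simp))
  simp only [pull, ← e, Functor.map_comp_apply]

/-- The Beck-Chevalley property of restriction and pushforward of decorations. -/
lemma push_pull_of_isPushout {A B D P : C} {f : A ⟶ D} {m : A ⟶ B} {m' : D ⟶ P} {j : B ⟶ P}
    (h : IsPushout f m m' j) (hm : fs.M m) (hm' : fs.M m') (s : F.obj ⟨B⟩) :
    push F f (pull F m hm s) = pull F m' hm' (push F j s) := by
  have e : (CMop.bwd m hm ≫ CMop.fwd f : (⟨B⟩ : CMop fs.M) ⟶ ⟨D⟩) =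
      CMop.fwd j ≫ CMop.bwd m' hm' := by
    refine (CMop.cls_comp_cls (X := ⟨B⟩) (Y := ⟨A⟩) (Z := ⟨D⟩) ⟨B, 𝟙 _, m, hm⟩
      ⟨D, f, 𝟙 _, fs.M.id_mem _⟩ h.flip (by simpa using hm')).trans ?_
    refine Eq.trans ?_ (CMop.fwd_comp_cls j ⟨P, 𝟙 _, m', hm'⟩).symm
    exact CMop.cls_eq (Iso.refl _) (by simp) (by simp)
  simp only [push, pull, ← Functor.map_comp_apply, e]

lemma pull_id {N : C} (s : F.obj ⟨N⟩) : pull F (𝟙 N) (fs.M.id_mem _) s = s := by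
  change F.map (𝟙 _) s = s
  simp

section Lax

variable [F.LaxMonoidal]

/-- Naturality of `φ` at the reversed maps of `C ; M^op`; `push_lax` is its counterpart for maps of
`C`. -/
lemma pull_lax {N M N' M' : C} (f : N ⟶ N') (g : M ⟶ M') (hf : fs.M f) (hg : fs.M g)
    (s : F.obj ⟨N'⟩) (t : F.obj ⟨M'⟩) :
    pull F (coprod.map f g) (coprod_mem fs.M hf hg) (lax F s t) =
      lax F (pull F f hf s) (pull F g hg t) := by
  have h := Functor.LaxMonoidal.μ_natural F
    (CMop.bwd f hf : (⟨N'⟩ : CMop fs.M) ⟶ ⟨N⟩) (CMop.bwd g hg : (⟨M'⟩ : CMop fs.M) ⟶ ⟨M⟩)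
  have e : (CMop.bwd (coprod.map f g) (coprod_mem fs.M hf hg) : (⟨N' ⨿ M'⟩ : CMop fs.M) ⟶ _) =
      CMop.tensor (CMop.bwd f hf : (⟨N'⟩ : CMop fs.M) ⟶ ⟨N⟩)
        (CMop.bwd g hg : (⟨M'⟩ : CMop fs.M) ⟶ ⟨M⟩) :=
    CMop.cls_eq (Iso.refl _) (by simp [CMop.tensorCospan]) (by simp [CMop.tensorCospan])
  unfold pull
  rw [e]
  exact (ConcreteCategory.congr_hom h ((s, t) : F.obj ⟨N'⟩ × F.obj ⟨M'⟩)).symm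

lemma push_lax_left {N M N' : C} (f : N ⟶ N') (s : F.obj ⟨N⟩) (t : F.obj ⟨M⟩) :
    lax F (push F f s) t = push F (coprod.map f (𝟙 M)) (lax F s t) := by
  rw [push_lax, push_id]

lemma push_lax_right {N M M' : C} (g : M ⟶ M') (s : F.obj ⟨N⟩) (t : F.obj ⟨M⟩) :
    lax F s (push F g t) = push F (coprod.map (𝟙 N) g) (lax F s t) := by
  rw [push_lax, push_id]

@[simp]
lemma push_emptyDec {N N' : C} (f : N ⟶ N') : push F f (emptyDec F N) = emptyDec F N' := by
  rw [emptyDec, push_push, emptyDec]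
  congr 1
  exact initial.hom_ext _ _

/-- Right unitality of `φ`, transported from `∅` to `M`: juxtaposing with an empty decoration adds
no information. -/
lemma lax_emptyDec {N : C} (M : C) (s : F.obj ⟨N⟩) :
    lax F s (emptyDec F M) = push F coprod.inl s := by
  have h := Functor.LaxMonoidal.right_unitality F (⟨N⟩ : CMop fs.M)
  have h' : s = push F (coprod.rightUnitor N).hom
      (lax F s ((Functor.LaxMonoidal.ε F : PUnit.{w + 1} ⟶ F.obj ⟨⊥_ C⟩) PUnit.unit)) :=
    (ConcreteCategory.congr_hom h ((s, PUnit.unit) : F.obj ⟨N⟩ × PUnit.{w + 1}) :)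
  rw [emptyDec, push_lax_right]
  -- Only the `s` on the right is expanded by unitality, so that both sides push forward the same
  -- element of `F (N + ∅)`.
  nth_rw 2 [h']
  rw [push_push]
  congr 1
  ext
  simp

lemma emptyDec_lax {N : C} (M : C) (s : F.obj ⟨N⟩) :
    lax F (emptyDec F M) s = push F coprod.inr s := by
  have h := Functor.LaxMonoidal.left_unitality F (⟨N⟩ : CMop fs.M)
  have h' : s = push F (coprod.leftUnitor N).hom
      (lax F ((Functor.LaxMonoidal.ε F : PUnit.{w + 1} ⟶ F.obj ⟨⊥_ C⟩) PUnit.unit) s) :=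
    (ConcreteCategory.congr_hom h ((PUnit.unit, s) : PUnit.{w + 1} × F.obj ⟨N⟩) :)
  rw [emptyDec, push_lax_left]
  nth_rw 2 [h']
  rw [push_push]
  congr 1
  ext
  simp

lemma push_associator_lax {N M P : C} (s : F.obj ⟨N⟩) (t : F.obj ⟨M⟩) (r : F.obj ⟨P⟩) :
    push F (coprod.associator N M P).hom (lax F (lax F s t) r) = lax F s (lax F t r) :=
  ConcreteCategory.congr_hom (Functor.LaxMonoidal.associativity F (⟨N⟩ : CMop fs.M) ⟨M⟩ ⟨P⟩)
    (((s, t), r) : (F.obj ⟨N⟩ × F.obj ⟨M⟩) × F.obj ⟨P⟩)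

/-- Oriented for rewriting: every product of decorations becomes left-nested. -/
lemma lax_lax {N M P : C} (s : F.obj ⟨N⟩) (t : F.obj ⟨M⟩) (r : F.obj ⟨P⟩) :
    lax F s (lax F t r) = push F (coprod.associator N M P).hom (lax F (lax F s t) r) :=
  (push_associator_lax s t r).symm

end Lax

lemma push_braiding_lax [F.LaxBraided] {N M : C} (s : F.obj ⟨N⟩) (t : F.obj ⟨M⟩) :
    push F (coprod.braiding N M).hom (lax F s t) = lax F t s :=
  ConcreteCategory.congr_hom (Functor.LaxBraided.braided (F := F) (⟨N⟩ : CMop fs.M) ⟨M⟩)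
    ((s, t) : F.obj ⟨N⟩ × F.obj ⟨M⟩)

/-- The middle four interchange for decorations. -/
lemma push_interchange_lax [F.LaxBraided] {N M N' M' : C} (s : F.obj ⟨N⟩) (s' : F.obj ⟨N'⟩)
    (t : F.obj ⟨M⟩) (t' : F.obj ⟨M'⟩) :
    push F (DecCorel.interchange N N' M M').hom (lax F (lax F s s') (lax F t t')) =
      lax F (lax F s t) (lax F s' t') := by
  -- The two arrangements differ only by exchanging `s'` and `t`. After reassociation in `h1` and
  -- `h2` this is a single braiding.
  have h : lax F (lax F s' t) t' =
      push F (coprod.map (coprod.braiding M N').hom (𝟙 _)) (lax F (lax F t s') t') := by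
    rw [push_lax, push_braiding_lax, push_id]
  have h1 : lax F (lax F s s') (lax F t t') = push F (coprod.associator _ _ _).inv
      (lax F s (push F (coprod.associator _ _ _).hom (lax F (lax F s' t) t'))) := by
    rw [push_associator_lax, lax_lax s s', push_push, Iso.hom_inv_id, push_id]
  have h2 : lax F (lax F s t) (lax F s' t') = push F (coprod.associator _ _ _).inv
      (lax F s (push F (coprod.associator _ _ _).hom (lax F (lax F t s') t'))) := by
    rw [push_associator_lax, lax_lax s t, push_push, Iso.hom_inv_id, push_id]
  rw [h1, h2, h]
  simp only [push_lax_right, push_push]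
  congr 1
  ext <;> simp [DecCorel.interchange]

/-! ### Restriction, composition and monoidal product of decorated cospans -/

namespace DecCospan

lemma Rel.of_eq_push {X Y : C} {a : DecCospan F X Y} {N : C} (n : a.apex ≅ N) {i : X ⟶ N}
    {o : Y ⟶ N} {s : F.obj ⟨N⟩} (hi : a.inl ≫ n.hom = i) (ho : a.inr ≫ n.hom = o)
    (hs : push F n.hom a.dec = s) : a.Rel ⟨N, i, o, s⟩ :=
  ⟨n, hi, ho, hs⟩

/-- The `M`-factor of the copairing of a decorated cospan, as a morphism from its restriction. -/
lemma exists_restrict_hom {X Y : C} (a : DecCospan F X Y) :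
    ∃ (m : a.restrict.apex ⟶ a.apex) (hm : fs.M m), a.restrict.inl ≫ m = a.inl ∧
      a.restrict.inr ≫ m = a.inr ∧ a.restrict.dec = pull F m hm a.dec :=
  ⟨fs.m (coprod.desc a.inl a.inr), fs.m_mem _, by simp [restrict, fs.e_m],
    by simp [restrict, fs.e_m], rfl⟩

/-- Restriction does not see an `M`-morphism along which the decoration has been restricted. -/
lemma restrict_rel_of_mem {X Y : C} (a b : DecCospan F X Y) (m : a.apex ⟶ b.apex) (hm : fs.M m)
    (h1 : a.inl ≫ m = b.inl) (h2 : a.inr ≫ m = b.inr) (h3 : pull F m hm b.dec = a.dec) :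
    a.restrict.toDecCospan.Rel b.restrict.toDecCospan := by
  -- The `E`-factor of `a`, followed by its `M`-factor and then `m`, is also a factorisation of the
  -- copairing of `b`; uniqueness of factorisations compares the two middle objects.
  have hm' := fs.M.comp_mem _ _ (fs.m_mem (coprod.desc a.inl a.inr)) hm
  obtain ⟨s, hs1, hs2⟩ := fs.exists_iso (Iso.refl _) (fs.e_mem (coprod.desc a.inl a.inr)) hm'
    (fs.e_mem (coprod.desc b.inl b.inr)) (fs.m_mem _)
    (by rw [← Category.assoc, fs.e_m, fs.e_m]; ext <;> simp [h1, h2])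
  refine ⟨s, by simp [restrict, hs1], by simp [restrict, hs1], ?_⟩
  have := push_pull (F := F) hm' (fs.m_mem _) (Iso.refl _) s hs2 b.dec
  rw [← pull_pull _ _ (fs.m_mem _) hm, h3, Iso.refl_hom, push_id] at this
  exact this

/-- A decorated corelation is its own restriction. -/
lemma _root_.DecoratedCorelation.DecCorel.restrict_rel {X Y : C} (a : DecCorel F X Y) :
    a.toDecCospan.restrict.toDecCospan.Rel a.toDecCospan := by
  -- For a corelation the copairing followed by the identity is itself an `(E, M)`-factorisation.
  obtain ⟨s, hs1, hs2⟩ := fs.exists_iso (Iso.refl _) (fs.e_mem (coprod.desc a.inl a.inr))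
    (fs.m_mem _) a.jointly_E (fs.M.id_mem _) (by simp [fs.e_m])
  refine ⟨s, by simp [restrict, hs1], by simp [restrict, hs1], ?_⟩
  have := push_pull (F := F) (fs.m_mem _) (fs.M.id_mem _) (Iso.refl _) s hs2 a.dec
  rw [Iso.refl_hom, push_id, pull_id] at this
  exact this

section Lax

variable [F.LaxMonoidal]

/-- The composite can be computed with any pushout. -/
lemma comp_rel_of_isPushout {X Y Z : C} (a : DecCospan F X Y) (b : DecCospan F Y Z) {P : C}
    {j : a.apex ⟶ P} {k : b.apex ⟶ P} (h : IsPushout a.inr b.inl j k) :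
    (a.comp b).Rel ⟨P, a.inl ≫ j, b.inr ≫ k, push F (coprod.desc j k) (lax F a.dec b.dec)⟩ := by
  have key : coprod.desc (pushout.inl a.inr b.inl) (pushout.inr a.inr b.inl) ≫
      ((IsPushout.of_hasPushout a.inr b.inl).isoIsPushout _ _ h).hom = coprod.desc j k := by
    ext <;> simp
  exact Rel.of_eq_push ((IsPushout.of_hasPushout a.inr b.inl).isoIsPushout _ _ h)
    (by simp [comp]) (by simp [comp])
    ((push_push _ _ _).trans (congrArg (fun f => push F f _) key))

/-- Restriction is compatible with composition. -/
lemma restrict_comp_restrict {X Y Z : C} (a : DecCospan F X Y) (b : DecCospan F Y Z) :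
    (a.restrict.toDecCospan.comp b.restrict.toDecCospan).restrict.toDecCospan.Rel
      (a.comp b).restrict.toDecCospan := by
  obtain ⟨m, hm, ha, ha', had⟩ := a.exists_restrict_hom
  obtain ⟨m', hm', hb, hb', hbd⟩ := b.exists_restrict_hom
  have h := IsPushout.of_hasPushout a.restrict.inr b.restrict.inl
  have h' : IsPushout (a.restrict.inr ≫ m) (b.restrict.inl ≫ m')
      (pushout.inl a.inr b.inl) (pushout.inr a.inr b.inl) := by
    rw [ha', hb]; exact IsPushout.of_hasPushout a.inr b.inl
  have hw : a.restrict.inr ≫ m ≫ pushout.inl a.inr b.inl =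
      b.restrict.inl ≫ m' ≫ pushout.inr a.inr b.inl := by
    rw [← Category.assoc, ← Category.assoc, h'.w]
  -- This one square serves twice: it places the comparison of pushouts in `M`, and it gives the
  -- Beck-Chevalley identity for the decorations.
  have hsq := isPushout_desc_map h h' (t := h.desc _ _ hw) (by simp) (by simp)
  have hmm := coprod_mem fs.M hm hm'
  have hM : fs.M (h.desc _ _ hw) := fs.M.of_isPushout hsq hmm
  refine restrict_rel_of_mem _ _ (h.desc _ _ hw) hM ?_ ?_ ?_
  · simp [comp, ← ha]
  · simp [comp, ← hb']
  · refine (push_pull_of_isPushout hsq hmm hM (lax F a.dec b.dec)).symm.trans ?_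
    rw [pull_lax _ _ hm hm', ← had, ← hbd]
    rfl

/-- Restriction is compatible with the monoidal product. -/
lemma restrict_tensor_restrict {X Y X' Y' : C} (a : DecCospan F X Y) (b : DecCospan F X' Y') :
    (a.restrict.tensor b.restrict).toDecCospan.Rel (a.tensor b).restrict.toDecCospan := by
  obtain ⟨m, hm, ha, ha', had⟩ := a.exists_restrict_hom
  obtain ⟨m', hm', hb, hb', hbd⟩ := b.exists_restrict_hom
  -- The left side is already a corelation because `E` is closed under coproducts, so it may be
  -- replaced by its own restriction.
  refine (DecCorel.restrict_rel _).symm.trans ?_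
  refine restrict_rel_of_mem _ _ (coprod.map m m') (coprod_mem fs.M hm hm') ?_ ?_ ?_
  · simp [DecCorel.tensor, tensor, ha, hb]
  · simp [DecCorel.tensor, tensor, ha', hb']
  · refine (pull_lax m m' hm hm' a.dec b.dec).trans ?_
    rw [← had, ← hbd]
    rfl

/-- Gluing the two inner pushouts along the apex of `b` gives one object which, by pasting, computes
both bracketings. Both decorations are then pushed forward from the same triple product. -/
lemma comp_assoc_rel {W X Y Z : C} (a : DecCospan F W X) (b : DecCospan F X Y)
    (c : DecCospan F Y Z) : ((a.comp b).comp c).Rel (a.comp (b.comp c)) := by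
  have hT := IsPushout.of_hasPushout (pushout.inr a.inr b.inl) (pushout.inl b.inr c.inl)
  have hl := (IsPushout.of_hasPushout b.inr c.inl).paste_horiz hT
  have hr := (IsPushout.of_hasPushout a.inr b.inl).paste_vert hT
  refine ((a.comp b).comp_rel_of_isPushout c hl).trans (Rel.symm ?_)
  refine (a.comp_rel_of_isPushout (b.comp c) hr).trans ?_
  refine Rel.of_eq_push (Iso.refl _) (by simp [comp]) (by simp [comp]) ?_
  simp only [comp, push_lax_left, push_lax_right, push_push, lax_lax]
  congr 1
  ext <;> simp [pushout.condition]

end Lax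

/-- A coproduct of pushouts is a pushout, but the four decorations arrive in two different orders;
the symmetry of `φ` reconciles them. -/
lemma tensor_comp_rel [F.LaxBraided] {X Y Z X' Y' Z' : C} (a : DecCospan F X Y)
    (a' : DecCospan F X' Y') (b : DecCospan F Y Z) (b' : DecCospan F Y' Z') :
    ((a.tensor a').comp (b.tensor b')).Rel ((a.comp b).tensor (a'.comp b')) := by
  refine (comp_rel_of_isPushout (a.tensor a') (b.tensor b')
    (isPushout_coprod_map (IsPushout.of_hasPushout a.inr b.inl)
      (IsPushout.of_hasPushout a'.inr b'.inl))).trans ?_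
  refine Rel.of_eq_push (Iso.refl _) (by simp [tensor, comp]) (by simp [tensor, comp]) ?_
  simp only [comp, tensor, push_lax_left, push_lax_right, push_push]
  rw [← push_interchange_lax, push_push]
  congr 1
  ext <;> simp [DecCorel.interchange]

end DecCospan

/-! ### The operations of `FCorel` on decorated cospans -/

namespace FCorel

lemma square_congr {X Y : FCorel F} {a b : DecCospan F X.of Y.of} (h : a.Rel b) :
    (square a : Hom X Y) = square b :=
  Quotient.sound (DecCospan.restrict_rel h)

lemma square_toDecCospan {X Y : FCorel F} (a : DecCorel F X.of Y.of) :
    (square a.toDecCospan : Hom X Y) = Quotient.mk _ a :=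
  Quotient.sound a.restrict_rel

/-! ### The category structure -/

section Category

variable [F.LaxMonoidal]

/-- Taking the operations from `data` keeps the final comparison with `data` definitional. -/
instance : CategoryStruct (FCorel F) where
  Hom := (data F).Hom
  id := (data F).id
  comp := (data F).comp

/-- The morphism of `FCorel` given by a decorated cospan, as a morphism of the category. -/
def cls {X Y : FCorel F} (a : DecCospan F X.of Y.of) : X ⟶ Y := square a

lemma cls_congr {X Y : FCorel F} {a b : DecCospan F X.of Y.of} (h : a.Rel b) :
    (cls a : X ⟶ Y) = cls b :=
  square_congr h

lemma cls_eq {X Y : FCorel F} {a b : DecCospan F X.of Y.of} (n : a.apex ≅ b.apex)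
    (h1 : a.inl ≫ n.hom = b.inl) (h2 : a.inr ≫ n.hom = b.inr) (h3 : push F n.hom a.dec = b.dec) :
    (cls a : X ⟶ Y) = cls b :=
  cls_congr ⟨n, h1, h2, h3⟩

/-- Frees later arguments from the `E`-condition: a corelation is the restriction of itself as a
cospan, so arbitrary decorated cospans suffice as representatives. -/
lemma ind {X Y : FCorel F} {p : (X ⟶ Y) → Prop} (h : ∀ a : DecCospan F X.of Y.of, p (cls a))
    (f : X ⟶ Y) : p f := by
  refine Quotient.ind (motive := p) (fun a => ?_) f
  have := h a.toDecCospan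
  rwa [cls, square_toDecCospan] at this

lemma cls_comp {X Y Z : FCorel F} (a : DecCospan F X.of Y.of) (b : DecCospan F Y.of Z.of) :
    (cls a : X ⟶ Y) ≫ (cls b : Y ⟶ Z) = cls (a.comp b) :=
  Quotient.sound (a.restrict_comp_restrict b)

lemma cls_comp_of_isPushout {X Y Z : FCorel F} (a : DecCospan F X.of Y.of)
    (b : DecCospan F Y.of Z.of) {P : C} {j : a.apex ⟶ P} {k : b.apex ⟶ P}
    (h : IsPushout a.inr b.inl j k) :
    (cls a : X ⟶ Y) ≫ (cls b : Y ⟶ Z) =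
      cls ⟨P, a.inl ≫ j, b.inr ≫ k, push F (coprod.desc j k) (lax F a.dec b.dec)⟩ :=
  (cls_comp a b).trans (cls_congr (a.comp_rel_of_isPushout b h))

/-- A morphism `f : X ⟶ Y` of `C`, regarded as the restriction of the cospan `X ⟶ Y = Y` with the
empty decoration. -/
def fwd {X Y : C} (f : X ⟶ Y) : (⟨X⟩ : FCorel F) ⟶ ⟨Y⟩ := cls (DecCospan.empty F f (𝟙 Y))

/-- A morphism `f : X ⟶ Y` of `C`, regarded as the restriction of the cospan `Y = Y ⟵ X` with the
empty decoration. -/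
def bwd {X Y : C} (f : X ⟶ Y) : (⟨Y⟩ : FCorel F) ⟶ ⟨X⟩ := cls (DecCospan.empty F (𝟙 Y) f)

lemma fwd_id (X : C) : (fwd (𝟙 X) : (⟨X⟩ : FCorel F) ⟶ ⟨X⟩) = 𝟙 _ := rfl

/-- The pushout is along an identity and the empty decoration is absorbed, so only the left leg
changes. `cls_comp_bwd` is the mirror image. -/
lemma fwd_comp_cls {X Y Z : C} (f : X ⟶ Y) (a : DecCospan F Y Z) :
    (fwd f : (⟨X⟩ : FCorel F) ⟶ ⟨Y⟩) ≫ (cls a : _ ⟶ ⟨Z⟩) =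
      cls ⟨a.apex, f ≫ a.inl, a.inr, a.dec⟩ :=
  (cls_comp_of_isPushout (X := ⟨X⟩) (Y := ⟨Y⟩) (Z := ⟨Z⟩) (DecCospan.empty F f (𝟙 Y)) a
    (j := a.inl) (k := 𝟙 _) IsPushout.of_id_fst).trans
    (cls_eq (Iso.refl _) (by simp [DecCospan.empty]) (by simp)
      (by simp [DecCospan.empty, emptyDec_lax, push_push, push_id]))

lemma cls_comp_bwd {X Y Z : C} (a : DecCospan F X Y) (f : Z ⟶ Y) :
    (cls a : (⟨X⟩ : FCorel F) ⟶ ⟨Y⟩) ≫ (bwd f : _ ⟶ ⟨Z⟩) =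
      cls ⟨a.apex, a.inl, f ≫ a.inr, a.dec⟩ :=
  (cls_comp_of_isPushout (X := ⟨X⟩) (Y := ⟨Y⟩) (Z := ⟨Z⟩) a (DecCospan.empty F (𝟙 Y) f)
    (j := 𝟙 _) (k := a.inr) IsPushout.of_id_snd).trans
    (cls_eq (Iso.refl _) (by simp) (by simp [DecCospan.empty])
      (by simp [DecCospan.empty, lax_emptyDec, push_push, push_id]))

instance : Category (FCorel F) where
  id_comp {X Y} f := by
    induction f using ind with | _ a
    exact (fwd_comp_cls (𝟙 X.of) a).trans
      (cls_eq (Iso.refl _) (by simp) (by simp) (by simp [push_id]))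
  comp_id {X Y} f := by
    induction f using ind with | _ a
    exact (cls_comp_bwd a (𝟙 Y.of)).trans
      (cls_eq (Iso.refl _) (by simp) (by simp) (by simp [push_id]))
  assoc {W X Y Z} f g h := by
    induction f using ind with | _ a
    induction g using ind with | _ b
    induction h using ind with | _ c
    simp only [cls_comp]
    exact cls_congr (a.comp_assoc_rel b c)

lemma fwd_comp {X Y Z : C} (f : X ⟶ Y) (g : Y ⟶ Z) :
    (fwd f : (⟨X⟩ : FCorel F) ⟶ ⟨Y⟩) ≫ fwd g = fwd (f ≫ g) := fwd_comp_cls _ _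

lemma bwd_comp {X Y Z : C} (f : X ⟶ Y) (g : Y ⟶ Z) :
    (bwd g : (⟨Z⟩ : FCorel F) ⟶ ⟨Y⟩) ≫ bwd f = bwd (f ≫ g) := cls_comp_bwd _ _

lemma fwd_comp_bwd {X Y N : C} (f : X ⟶ N) (g : Y ⟶ N) :
    (fwd f : (⟨X⟩ : FCorel F) ⟶ ⟨N⟩) ≫ bwd g = cls (DecCospan.empty F f g) :=
  (fwd_comp_cls f (DecCospan.empty F (𝟙 N) g)).trans
    (cls_eq (Iso.refl _) (by simp [DecCospan.empty]) (by simp [DecCospan.empty])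
      (by simp [DecCospan.empty]))

/-- The source of the special and Frobenius laws: each becomes the assertion that a square of
codiagonals is a pushout. -/
lemma bwd_comp_fwd {Y N M P : C} {f : Y ⟶ N} {g : Y ⟶ M} {j : N ⟶ P} {k : M ⟶ P}
    (h : IsPushout f g j k) :
    (bwd f : (⟨N⟩ : FCorel F) ⟶ ⟨Y⟩) ≫ fwd g = fwd j ≫ bwd k := by
  rw [fwd_comp_bwd]
  exact (cls_comp_of_isPushout (X := ⟨N⟩) (Y := ⟨Y⟩) (Z := ⟨M⟩) (DecCospan.empty F (𝟙 N) f)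
    (DecCospan.empty F g (𝟙 M)) h).trans
    (cls_eq (Iso.refl _) (by simp [DecCospan.empty]) (by simp [DecCospan.empty])
      (by simp [DecCospan.empty, lax_emptyDec]))

lemma bwd_hom {X Y : C} (f : X ≅ Y) : (bwd f.hom : (⟨Y⟩ : FCorel F) ⟶ ⟨X⟩) = fwd f.inv :=
  cls_eq f.symm (by simp [DecCospan.empty]) (by simp [DecCospan.empty])
    (by simp [DecCospan.empty])

lemma fwd_hom {X Y : C} (f : X ≅ Y) : (fwd f.hom : (⟨X⟩ : FCorel F) ⟶ ⟨Y⟩) = bwd f.inv :=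
  (bwd_hom f.symm).symm

/-- Naturality of an isomorphism of `C` with respect to decorated cospans. -/
lemma naturality {X Y X' Y' : C} (a : DecCospan F X Y) (b : DecCospan F X' Y')
    (n : a.apex ≅ b.apex) (f : X ⟶ X') (g : Y ≅ Y') (h1 : a.inl ≫ n.hom = f ≫ b.inl)
    (h2 : a.inr ≫ n.hom = g.hom ≫ b.inr) (h3 : push F n.hom a.dec = b.dec) :
    (cls a : (⟨X⟩ : FCorel F) ⟶ ⟨Y⟩) ≫ fwd g.hom = fwd f ≫ (cls b : _ ⟶ ⟨Y'⟩) := by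
  -- Turning the isomorphism `g` into the reversed cospan of its inverse makes both composites a
  -- mere change of leg.
  rw [fwd_hom, cls_comp_bwd, fwd_comp_cls]
  exact cls_eq n h1 (by simp [h2]) h3

/-- An isomorphism of `C`, regarded as an isomorphism of `FCorel`. -/
@[simps]
def fwdIso {X Y : C} (f : X ≅ Y) : (⟨X⟩ : FCorel F) ≅ ⟨Y⟩ where
  hom := fwd f.hom
  inv := fwd f.inv
  hom_inv_id := by rw [fwd_comp, f.hom_inv_id, fwd_id]
  inv_hom_id := by rw [fwd_comp, f.inv_hom_id, fwd_id]

/-! ### The monoidal structure -/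

/-- The monoidal product of morphisms of `FCorel`. -/
def tensor {X Y X' Y' : FCorel F} (f : X ⟶ Y) (g : X' ⟶ Y') :
    (⟨X.of ⨿ X'.of⟩ : FCorel F) ⟶ ⟨Y.of ⨿ Y'.of⟩ :=
  (data F).tensorHom f g

lemma tensor_cls {X Y X' Y' : FCorel F} (a : DecCospan F X.of Y.of)
    (b : DecCospan F X'.of Y'.of) :
    tensor (cls a : X ⟶ Y) (cls b : X' ⟶ Y') = cls (a.tensor b) :=
  Quotient.sound (a.restrict_tensor_restrict b)

lemma tensor_empty {X Y X' Y' N N' : C} (i : X ⟶ N) (o : Y ⟶ N) (i' : X' ⟶ N') (o' : Y' ⟶ N') :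
    tensor (cls (DecCospan.empty F i o) : (⟨X⟩ : FCorel F) ⟶ ⟨Y⟩)
        (cls (DecCospan.empty F i' o') : (⟨X'⟩ : FCorel F) ⟶ ⟨Y'⟩) =
      cls (DecCospan.empty F (coprod.map i i') (coprod.map o o')) :=
  (tensor_cls _ _).trans
    (cls_eq (Iso.refl _) (by simp [DecCospan.tensor, DecCospan.empty])
      (by simp [DecCospan.tensor, DecCospan.empty])
      (by simp [DecCospan.tensor, DecCospan.empty, lax_emptyDec]))

lemma tensor_fwd {X Y X' Y' : C} (f : X ⟶ Y) (g : X' ⟶ Y') :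
    tensor (fwd f : (⟨X⟩ : FCorel F) ⟶ ⟨Y⟩) (fwd g : (⟨X'⟩ : FCorel F) ⟶ ⟨Y'⟩) =
      fwd (coprod.map f g) :=
  (tensor_empty _ _ _ _).trans (by rw [coprod.map_id_id]; rfl)

lemma tensor_bwd {X Y X' Y' : C} (f : X ⟶ Y) (g : X' ⟶ Y') :
    tensor (bwd f : (⟨Y⟩ : FCorel F) ⟶ ⟨X⟩) (bwd g : (⟨Y'⟩ : FCorel F) ⟶ ⟨X'⟩) =
      bwd (coprod.map f g) :=
  (tensor_empty _ _ _ _).trans (by rw [coprod.map_id_id]; rfl)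

end Category

variable [F.LaxBraided]

lemma tensor_comp {X Y Z X' Y' Z' : FCorel F} (f : X ⟶ Y) (f' : X' ⟶ Y') (g : Y ⟶ Z)
    (g' : Y' ⟶ Z') : tensor f f' ≫ tensor g g' = tensor (f ≫ g) (f' ≫ g') := by
  induction f using ind with | _ a
  induction f' using ind with | _ a'
  induction g using ind with | _ b
  induction g' using ind with | _ b'
  simp only [cls_comp, tensor_cls]
  exact cls_congr (a.tensor_comp_rel a' b b')

instance : MonoidalCategoryStruct (FCorel F) where
  tensorObj X Y := ⟨X.of ⨿ Y.of⟩
  tensorHom f g := tensor f g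
  whiskerLeft X _ _ g := tensor (𝟙 X) g
  whiskerRight f Y := tensor f (𝟙 Y)
  tensorUnit := ⟨⊥_ C⟩
  associator X Y Z := fwdIso (coprod.associator X.of Y.of Z.of)
  leftUnitor X := fwdIso (coprod.leftUnitor X.of)
  rightUnitor X := fwdIso (coprod.rightUnitor X.of)

instance : MonoidalCategory (FCorel F) :=
  MonoidalCategory.ofTensorHom
    (id_tensorHom_id := fun X Y => (tensor_fwd (𝟙 X.of) (𝟙 Y.of)).trans (by
      rw [coprod.map_id_id]; rfl))
    (id_tensorHom := fun _ _ _ _ => rfl)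
    (tensorHom_id := fun _ _ => rfl)
    (tensorHom_comp_tensorHom := fun f f' g g' => tensor_comp f f' g g')
    (associator_naturality := fun {X₁ X₂ X₃ Y₁ Y₂ Y₃} f g h => by
      induction f using ind with | _ a
      induction g using ind with | _ b
      induction h using ind with | _ c
      change tensor (tensor (cls a) (cls b)) (cls c) ≫ fwd _ =
        fwd _ ≫ tensor (cls a) (tensor (cls b) (cls c))
      simp only [tensor_cls]
      exact naturality ((a.tensor b).tensor c) (a.tensor (b.tensor c))
        (coprod.associator _ _ _) (coprod.associator _ _ _).hom (coprod.associator _ _ _)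
        (coprod.associator_naturality _ _ _) (coprod.associator_naturality _ _ _)
        (push_associator_lax _ _ _))
    (leftUnitor_naturality := fun {X Y} f => by
      induction f using ind with | _ a
      change tensor (cls (DecCospan.empty F _ _)) (cls a) ≫ fwd _ = fwd _ ≫ cls a
      rw [tensor_cls]
      exact naturality ((DecCospan.empty F _ _).tensor a) a
        (coprod.leftUnitor _) (coprod.leftUnitor _).hom (coprod.leftUnitor _)
        (coprod.leftUnitor_naturality _) (coprod.leftUnitor_naturality _)
        (by simp [DecCospan.tensor, DecCospan.empty, emptyDec_lax, push_push, push_id]))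
    (rightUnitor_naturality := fun {X Y} f => by
      induction f using ind with | _ a
      change tensor (cls a) (cls (DecCospan.empty F _ _)) ≫ fwd _ = fwd _ ≫ cls a
      rw [tensor_cls]
      exact naturality (a.tensor (DecCospan.empty F _ _)) a
        (coprod.rightUnitor _) (coprod.rightUnitor _).hom (coprod.rightUnitor _)
        (coprod.rightUnitor_naturality _) (coprod.rightUnitor_naturality _)
        (by simp [DecCospan.tensor, DecCospan.empty, lax_emptyDec, push_push, push_id]))
    (pentagon := fun W X Y Z => by
      change tensor (fwd _) (fwd (𝟙 _)) ≫ fwd _ ≫ tensor (fwd (𝟙 _)) (fwd _) = fwd _ ≫ fwd _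
      simp only [tensor_fwd, fwd_comp]
      exact congrArg fwd (coprod.pentagon _ _ _ _))
    (triangle := fun X Y => by
      change fwd _ ≫ tensor (fwd (𝟙 _)) (fwd _) = tensor (fwd _) (fwd (𝟙 _))
      simp only [tensor_fwd, fwd_comp]
      exact congrArg fwd (coprod.triangle _ _))

lemma braiding_naturality {X Y X' Y' : FCorel F} (f : X ⟶ Y) (g : X' ⟶ Y') :
    tensor f g ≫ fwd (coprod.braiding Y.of Y'.of).hom =
      fwd (coprod.braiding X.of X'.of).hom ≫ tensor g f := by
  induction f using ind with | _ a
  induction g using ind with | _ b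
  simp only [tensor_cls]
  exact naturality (a.tensor b) (b.tensor a) (coprod.braiding _ _)
    (coprod.braiding _ _).hom (coprod.braiding _ _)
    (by simp [DecCospan.tensor]) (by simp [DecCospan.tensor]) (push_braiding_lax _ _)

instance : SymmetricCategory (FCorel F) where
  braiding X Y := fwdIso (coprod.braiding X.of Y.of)
  braiding_naturality_right X _ _ f := braiding_naturality (𝟙 X) f
  braiding_naturality_left f Z := braiding_naturality f (𝟙 Z)
  hexagon_forward X Y Z := by
    change fwd _ ≫ fwd _ ≫ fwd _ = tensor (fwd _) (fwd (𝟙 _)) ≫ fwd _ ≫ tensor (fwd (𝟙 _)) (fwd _)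
    simp only [tensor_fwd, fwd_comp]
    exact congrArg fwd (CMop.hexagons _ _ _).1
  hexagon_reverse X Y Z := by
    change fwd _ ≫ fwd _ ≫ fwd _ = tensor (fwd (𝟙 _)) (fwd _) ≫ fwd _ ≫ tensor (fwd _) (fwd (𝟙 _))
    simp only [tensor_fwd, fwd_comp]
    exact congrArg fwd (CMop.hexagons _ _ _).2
  symmetry X Y := by
    change fwd _ ≫ fwd _ = 𝟙 _
    rw [fwd_comp, coprod.symmetry]
    rfl

/-! ### The hypergraph structure -/

/-- The Frobenius structure on `X` given by the codiagonal and the map from the initial object,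
in both directions. -/
@[reducible]
def frob (X : FCorel F) : SpecialCommFrobenius X where
  mul := fwd (codiag X.of)
  one := fwd (initial.to X.of)
  comul := bwd (codiag X.of)
  counit := bwd (initial.to X.of)
  one_mul := by
    change tensor (fwd _) (fwd (𝟙 _)) ≫ fwd _ = fwd _
    rw [tensor_fwd, fwd_comp]
    exact congrArg fwd (by ext; simp)
  mul_one := by
    change tensor (fwd (𝟙 _)) (fwd _) ≫ fwd _ = fwd _
    rw [tensor_fwd, fwd_comp]
    exact congrArg fwd (by ext; simp)
  mul_assoc := by
    change tensor (fwd _) (fwd (𝟙 _)) ≫ fwd _ = fwd _ ≫ tensor (fwd (𝟙 _)) (fwd _) ≫ fwd _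
    simp only [tensor_fwd, fwd_comp]
    exact congrArg fwd (by ext <;> simp)
  counit_comul := by
    -- The inverse unitor is written as the `hom` of the reversed isomorphism so that `fwd_hom`
    -- applies. The law is then the unit law of the codiagonal in `C`, reversed.
    change bwd _ ≫ tensor (bwd _) (bwd (𝟙 _)) = fwd (coprod.leftUnitor X.of).symm.hom
    rw [tensor_bwd, bwd_comp, fwd_hom]
    have h : coprod.map (initial.to X.of) (𝟙 X.of) ≫ codiag X.of =
      (coprod.leftUnitor X.of).hom := by ext; simp
    exact congrArg bwd h
  comul_counit := by
    change bwd _ ≫ tensor (bwd (𝟙 _)) (bwd _) = fwd (coprod.rightUnitor X.of).symm.hom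
    rw [tensor_bwd, bwd_comp, fwd_hom]
    have h : coprod.map (𝟙 X.of) (initial.to X.of) ≫ codiag X.of =
      (coprod.rightUnitor X.of).hom := by ext; simp
    exact congrArg bwd h
  comul_assoc := by
    change bwd _ ≫ tensor (bwd (𝟙 _)) (bwd _) = bwd _ ≫ tensor (bwd _) (bwd (𝟙 _)) ≫ fwd _
    rw [fwd_hom]
    simp only [tensor_bwd, bwd_comp]
    exact congrArg bwd (by ext <;> simp)
  mul_comm := by
    change fwd _ ≫ fwd _ = fwd _
    rw [fwd_comp]
    exact congrArg fwd (by ext <;> simp)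
  comul_comm := by
    change bwd _ ≫ fwd _ = bwd _
    rw [fwd_hom, bwd_comp]
    exact congrArg bwd (by ext <;> simp)
  frobenius_left := by
    change tensor (bwd _) (bwd (𝟙 _)) ≫ fwd _ ≫ tensor (fwd (𝟙 _)) (fwd _) = fwd _ ≫ bwd _
    rw [tensor_bwd, tensor_fwd, fwd_comp]
    exact bwd_comp_fwd (isPushout_frobenius X.of)
  frobenius_right := by
    change tensor (bwd (𝟙 _)) (bwd _) ≫ fwd _ ≫ tensor (fwd _) (fwd (𝟙 _)) = fwd _ ≫ bwd _
    rw [tensor_bwd, tensor_fwd, fwd_comp]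
    exact bwd_comp_fwd (isPushout_frobenius' X.of)
  special := by
    change bwd _ ≫ fwd _ = 𝟙 _
    rw [bwd_comp_fwd (isPushout_codiag X.of)]
    -- What remains is `fwd (𝟙 _) ≫ bwd (𝟙 _)`, and both factors are the identity by definition.
    exact Category.comp_id (𝟙 X)

/-- Each factor of `tensorμ` is a coherence map of `C` or a product of such maps with identities, so
the composite can be evaluated in `C`. -/
lemma tensorμ_eq_fwd (X X' Y Y' : FCorel F) :
    tensorμ X X' Y Y' = fwd (DecCorel.interchange X.of X'.of Y.of Y'.of).hom := by
  change fwd _ ≫ tensor (fwd (𝟙 _)) (fwd _) ≫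
    tensor (fwd (𝟙 _)) (tensor (fwd _) (fwd (𝟙 _))) ≫ tensor (fwd (𝟙 _)) (fwd _) ≫ fwd _ = _
  simp only [tensor_fwd, fwd_comp]
  exact congrArg fwd (by ext <;> simp [DecCorel.interchange] <;> rfl)

lemma codiag_coprod (X Y : C) : codiag (X ⨿ Y) =
    (DecCorel.interchange X Y X Y).hom ≫ coprod.map (codiag X) (codiag Y) := by
  ext <;> simp [DecCorel.interchange]

instance : HypergraphCategory (FCorel F) where
  frob := frob
  mul_tensor X Y := by
    rw [tensorμ_eq_fwd]
    change fwd _ = fwd _ ≫ tensor (fwd _) (fwd _)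
    rw [tensor_fwd, fwd_comp]
    exact congrArg fwd (codiag_coprod X.of Y.of)
  one_tensor X Y := by
    change fwd _ = fwd _ ≫ tensor (fwd _) (fwd _)
    rw [tensor_fwd, fwd_comp]
    exact congrArg fwd (initial.hom_ext _ _)
  comul_tensor X Y := by
    -- The inverse of the interchange for `X, X, Y, Y` has the same formula as the interchange for
    -- `X, Y, X, Y`, so `codiag_coprod` also settles this dual law.
    rw [tensorμ_eq_fwd, fwd_hom]
    change bwd _ = tensor (bwd _) (bwd _) ≫ bwd _
    rw [tensor_bwd, bwd_comp]
    exact congrArg bwd (codiag_coprod X.of Y.of)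
  counit_tensor X Y := by
    change bwd _ = tensor (bwd _) (bwd _) ≫ fwd (coprod.leftUnitor (⊥_ C)).hom
    rw [fwd_hom, tensor_bwd, bwd_comp]
    exact congrArg bwd (initial.hom_ext _ _)

end FCorel

end DecoratedCorelation

end

theorem mainTheorem3 {C : Type u} [Category.{v} C] [HasFiniteColimits C]
    (fs : DecoratedCorelation.FactorisationSystem C) [fs.Costable]
    (F : DecoratedCorelation.CMop fs.M ⥤ Type w) [F.LaxBraided] :
    ∃ (_ : Category.{max u v w} (DecoratedCorelation.FCorel F))
      (_ : MonoidalCategory (DecoratedCorelation.FCorel F))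
      (_ : SymmetricCategory (DecoratedCorelation.FCorel F))
      (_ : DecoratedCorelation.HypergraphCategory (DecoratedCorelation.FCorel F)),
      DecoratedCorelation.HypergraphData.of (DecoratedCorelation.FCorel F) =
        DecoratedCorelation.FCorel.data F :=
  -- `rfl` suffices because `fwd` and `bwd` unfold to `square` of cospans with the empty decoration,
  -- exactly as in `data`.
  ⟨inferInstance, inferInstance, inferInstance, inferInstance, rfl⟩
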